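/- Let $Q$ be a finite quiver with vertices $1,\dots,p$. A unitary (Euclidean) representation $A$ of $Q$ of dimension $d=(d_1,\dots,d_p)\in\mathbb N_0^p$ assigns to each arrow $\alpha:i\to j$ a complex (real) $d_j\times d_i$ matrix $A_\alpha$; a Euclidean representation is also regarded as a unitary one. Write $A\simeq_{\mathbb C}B$ (for unitary $A,B$), respectively $A\simeq_{\mathbb R}B$ (for Euclidean $A,B$), and call $A,B$ isometric, respectively $\mathbb R$-isometric, if they have the same dimension and there are unitary, respectively real orthogonal, matrices $S_1,\dots,S_p$ with $S_jA_\alpha=B_\alpha S_i$ for every arrow $\alpha:i\to j$. A unitary (Euclidean) representation is indecomposable ($\mathbb R$-indecomposable) if its dimension is nonzero and whenever it is isometric ($\mathbb R$-isometric) to a direct sum $B\oplus C$ of unitary (Euclidean) representations, $B$ or $C$ has dimension $0$. Let $\operatorname{ind}(Q)$ be a complete system of pairwise nonisometric indecomposable unitary representations in which every member that is isometric to a Euclidean representation is itself Euclidean, and let $\operatorname{ind}_0(Q)$ be the set of its Euclidean members. Let $\operatorname{ind}_1(Q)$ consist of all $A\in\operatorname{ind}(Q)$ that are isometric to their complex conjugate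 $\bar A$ but not to a Euclidean representation, together with exactly one representation from each pair $\{A,B\}\subset\operatorname{ind}(Q)$ such that $A\not\simeq_{\mathbb C}\bar A\simeq_{\mathbb C}B$. For a unitary representation $A$ of dimension $d$, let $A^{\mathbb R}$ be the Euclidean representation of dimension $2d$ obtained by replacing each entry $a+bi$ $(a,b\in\mathbb R)$ of the matrices of $A$ by the block $\begin{pmatrix}a&b\\-b&a\end{pmatrix}$. Let $M_Q=[m_{ij}]$, where $m_{ij}$ is the number of arrows $i\to j$ and $i\gets j$ (a loop is counted once), and for $z\in\mathbb N_0^p$ let $\operatorname{supp}(z)$ be the full subquiver with vertex set $\{i\mid z_i\neq0\}$. Let $D(Q)\subset\mathbb N_0^p$ consist of the unit vectors $e_1,\dots,e_p$, all $e_i+e_j$ with $m_{ij}=1$, and all nonzero $z$ with $zM_Q\ge z$ (entrywise) such that $\operatorname{supp}(z)$ is connected and is neither a single vertex without arrows nor a quiver consisting of two vertices and one arrow joining them. Then: (a) For Euclidean representations $A$ and $B$ of $Q$, $A\simeq_{\mathbb R}B$ if and only if $A\simeq_{\mathbb C}B$. (b) Every Euclidean representation is $\mathbb R$-isometric to a finite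 direct sum of $\mathbb R$-indecomposable Euclidean representations, and the summands are determined uniquely up to order and $\mathbb R$-isometry. Moreover, $\operatorname{ind}_0(Q)\cup\{A^{\mathbb R}\mid A\in\operatorname{ind}_1(Q)\}$ is a complete system of pairwise non-$\mathbb R$-isometric $\mathbb R$-indecomposable Euclidean representations of $Q$. (c) The set of dimensions of $\mathbb R$-indecomposable Euclidean representations of $Q$ coincides with the set of dimensions of indecomposable unitary representations of $Q$, and both are equal to $D(Q)$. -/

import Mathlib

open Matrix

universe u v

noncomputable section

/-- A matrix representation over `𝕜` of the quiver `V`: a dimension `d i` for each vertex, and a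
`d j × d i` matrix for each arrow `i ⟶ j`.  The space at the vertex `i` is `𝕜 ^ (d i)` with its
standard scalar product. A unitary representation is the case `𝕜 = ℂ`, a Euclidean representation
the case `𝕜 = ℝ`. -/
structure QuiverRep (𝕜 : Type) (V : Type u) [Quiver.{v} V] where
  dim : V → ℕ
  mat : ∀ {i j : V}, (i ⟶ j) → Matrix (Fin (dim j)) (Fin (dim i)) 𝕜

namespace QuiverRep

variable {V : Type u} [Quiver.{v} V]

section General

variable {𝕜 : Type} [RCLike 𝕜]

/-- `A ≃ B`: there are unitary (over `ℝ`: orthogonal) matrices `S i` with `S j A_α = B_α S i` for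
every arrow `α : i ⟶ j`. The two unitarity equations force `A.dim = B.dim`. -/
def Isometric (A B : QuiverRep 𝕜 V) : Prop :=
  ∃ S : ∀ i : V, Matrix (Fin (B.dim i)) (Fin (A.dim i)) 𝕜,
    (∀ i, (S i)ᴴ * S i = 1 ∧ S i * (S i)ᴴ = 1) ∧
    ∀ (i j : V) (α : i ⟶ j), S j * A.mat α = B.mat α * S i

/-- The orthogonal direct sum, given by block diagonal matrices. -/
def directSum (A B : QuiverRep 𝕜 V) : QuiverRep 𝕜 V where
  dim i := A.dim i + B.dim i
  mat α := Matrix.reindex finSumFinEquiv finSumFinEquiv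
    (Matrix.fromBlocks (A.mat α) 0 0 (B.mat α))

/-- The representation of dimension zero. -/
def zeroRep : QuiverRep 𝕜 V where
  dim _ := 0
  mat _ := 0

/-- `A₁ ⊕ ⋯ ⊕ Aₗ` for a finite list of representations. -/
def listSum (L : List (QuiverRep 𝕜 V)) : QuiverRep 𝕜 V :=
  L.foldr directSum zeroRep

/-- Indecomposability with respect to isometries (over `ℝ`: `ℝ`-indecomposability). -/
def Indecomposable (A : QuiverRep 𝕜 V) : Prop :=
  A.dim ≠ 0 ∧
    ∀ B C : QuiverRep 𝕜 V, A.Isometric (B.directSum C) → B.dim = 0 ∨ C.dim = 0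

/-- A complete system of pairwise nonisometric indecomposable representations. -/
def IsCompleteSystem (I : Set (QuiverRep 𝕜 V)) : Prop :=
  (∀ A ∈ I, A.Indecomposable) ∧
  (∀ A ∈ I, ∀ B ∈ I, A.Isometric B → A = B) ∧
  ∀ A : QuiverRep 𝕜 V, A.Indecomposable → ∃ B ∈ I, A.Isometric B

end General

/-- The unitary representation given by the same real matrices. -/
def complexify (A : QuiverRep ℝ V) : QuiverRep ℂ V where
  dim := A.dim
  mat α := (A.mat α).map (fun x : ℝ => (x : ℂ))

/-- The representation with complex conjugate matrices. -/
def conj (A : QuiverRep ℂ V) : QuiverRep ℂ V where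
  dim := A.dim
  mat α := (A.mat α).map (starRingEnd ℂ)

/-- The realification of a complex matrix: each entry `a + b i` is replaced by the `2 × 2` block
with rows `(a, b)` and `(-b, a)`. -/
def realifyMatrix {m n : ℕ} (M : Matrix (Fin m) (Fin n) ℂ) :
    Matrix (Fin (m * 2)) (Fin (n * 2)) ℝ :=
  Matrix.reindex finProdFinEquiv finProdFinEquiv
    (Matrix.of fun (r : Fin m × Fin 2) (c : Fin n × Fin 2) =>
      !![(M r.1 c.1).re, (M r.1 c.1).im; -(M r.1 c.1).im, (M r.1 c.1).re] r.2 c.2)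

/-- The realification of a unitary representation. -/
def realify (A : QuiverRep ℂ V) : QuiverRep ℝ V where
  dim i := A.dim i * 2
  mat α := realifyMatrix (A.mat α)

/-- A unitary representation all of whose matrices are real. -/
def IsEuclidean (A : QuiverRep ℂ V) : Prop :=
  ∃ B : QuiverRep ℝ V, A = B.complexify

/-- A unitary representation that is isometric to a Euclidean one. -/
def IsometricToEuclidean (A : QuiverRep ℂ V) : Prop :=
  ∃ B : QuiverRep ℝ V, A.Isometric B.complexify

/-- A complete system of nonisometric indecomposable unitary representations, in which every
member that is isometric to a Euclidean representation has been replaced by a Euclidean one. -/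
def IsNormalizedCompleteSystem (I : Set (QuiverRep ℂ V)) : Prop :=
  IsCompleteSystem I ∧ ∀ A ∈ I, A.IsometricToEuclidean → A.IsEuclidean

/-- The Euclidean members of `I`. -/
def indZero (I : Set (QuiverRep ℂ V)) : Set (QuiverRep ℝ V) :=
  {A | A.complexify ∈ I}

/-- `K` consists of all members of `I` that are isometric to their conjugates but not to a
Euclidean representation, together with exactly one representation from each pair
`{A, B} ⊆ I` such that `A` is not isometric to its conjugate and that conjugate is isometric
to `B`. -/
def IsIndOne (I K : Set (QuiverRep ℂ V)) : Prop :=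
  K ⊆ I ∧
  (∀ A ∈ I, A.Isometric A.conj → (A ∈ K ↔ ¬ A.IsometricToEuclidean)) ∧
  ∀ A ∈ I, ∀ B ∈ I, ¬ A.Isometric A.conj → A.conj.Isometric B → Xor (A ∈ K) (B ∈ K)

end QuiverRep

namespace QuiverDim

variable (V : Type u) [Quiver.{v} V] [DecidableEq V] [∀ i j : V, Fintype (i ⟶ j)]

/-- The matrix whose entry `(i, j)` is the number of arrows between `i` and `j`, in either
direction; a loop is counted once. -/
def arrowMatrix : Matrix V V ℕ := fun i j =>
  if i = j then Fintype.card (i ⟶ i) else Fintype.card (i ⟶ j) + Fintype.card (j ⟶ i)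

/-- The underlying simple graph of the quiver. -/
def underlyingGraph : SimpleGraph V := SimpleGraph.fromRel fun i j => Nonempty (i ⟶ j)

variable {V}

/-- The full subquiver on the vertices with `z i ≠ 0` is connected. -/
def SuppConnected (z : V → ℕ) : Prop :=
  ((underlyingGraph V).induce {i | z i ≠ 0}).Connected

/-- The full subquiver on the vertices with `z i ≠ 0` is a single vertex without arrows. -/
def SuppIsPoint (z : V → ℕ) : Prop :=
  ∃ i, {k | z k ≠ 0} = {i} ∧ arrowMatrix V i i = 0

/-- The full subquiver on the vertices with `z i ≠ 0` consists of two vertices and one arrow, and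
this arrow joins the two vertices. -/
def SuppIsArrow (z : V → ℕ) : Prop :=
  ∃ i j, i ≠ j ∧ {k | z k ≠ 0} = {i, j} ∧
    arrowMatrix V i j = 1 ∧ arrowMatrix V i i = 0 ∧ arrowMatrix V j j = 0

variable (V)

/-- The set `D(Q)` of dimension vectors: all `e i`, all `e i + e j` for vertices `i`, `j` joined by
exactly one arrow, and all nonzero `z` with `z M ≥ z` (`M` the arrow matrix) whose support is
connected and is neither a single vertex without arrows nor two vertices joined by one arrow. -/
def dimSet [Fintype V] : Set (V → ℕ) :=
  {z | (∃ i, z = Pi.single i 1) ∨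
    (∃ i j, arrowMatrix V i j = 1 ∧ z = Pi.single i 1 + Pi.single j 1) ∨
    (z ≠ 0 ∧ SuppConnected z ∧ ¬ SuppIsPoint z ∧ ¬ SuppIsArrow z ∧
      z ≤ z ᵥ* arrowMatrix V)}

end QuiverDim

end

/-!
# Unitary and Euclidean representations of a quiver

Everything rests on the matrices `S i` that intertwine both the matrices of two representations and
their adjoints (`QuiverRep.homSpace`). Every isometry is of this kind, and the space is closed under
adjoints. Hence the spectral theorem splits a representation along the eigenspaces of a Hermitian
endomorphism, and a nonzero representation is indecomposable if and only if its only Hermitian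
endomorphisms are scalars (`QuiverRep.indecomposable_iff`). This holds over `ℝ` and over `ℂ`, and
implies Schur's lemma in the following form: indecomposable representations with a nonzero
intertwiner between them are isometric (`QuiverRep.Indecomposable.isometric`).

The dimension of the intertwiner space is additive in direct sums. With Schur's lemma, the
dimensions of the intertwiner spaces into a representation therefore determine its indecomposable
summands (`QuiverRep.exists_perm_forall₂`), which gives the uniqueness of decompositions. The real
and imaginary parts of an intertwiner between Euclidean representations are intertwiners, so these
dimensions do not change under complexification; thus isometry over `ℂ` implies isometry over `ℝ`
(`QuiverRep.isometric_iff_complexify`).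

For the classification, intertwiners from the realification of a unitary `X` to a Euclidean `A`
correspond to intertwiners from `X` to the complexification of `A`
(`QuiverRep.realifyRows_mem_homSpace`), and the complexification of the realification of `X` is the
sum of `X` and its conjugate. If the realification of an indecomposable `X` decomposed, both parts
would contain `X` over `ℂ`, and `X` would be isometric to either of them by dimension reasons. So
the realification is indecomposable unless `X` is isometric to a Euclidean representation
(`QuiverRep.Indecomposable.realify`), and the complete system is found by Schur's lemma
(`QuiverRep.isCompleteSystem_indZero_union`).

The dimensions of indecomposable representations are treated over `ℝ` and `ℂ` at once. They lie in
`D(Q)` because violating one of the conditions produces an explicit non-scalar Hermitian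
endomorphism: the projection onto a component of the support, the projection onto a vector killed by
all matrices at a vertex, or, if the support is a single arrow between two vertices, a projection
onto a coordinate line carried along that arrow (`QuiverRep.Indecomposable.dim_mem_dimSet`).
Conversely, a vector with entries at most one and connected support is realized by matrices `1`, and
the other ones are reached by raising one entry at a time. At a vertex with a loop the new matrix on
the loops is chosen such that only scalars commute with it. At a vertex without loops, with all
adjacent matrices collected in a matrix `T`, the new coordinate is attached by a vector `w` in the
kernel of `T`; an endomorphism cannot mix it with the old coordinates if `‖w‖²` is not an eigenvalue
of `T Tᴴ` (`QuiverRep.Indecomposable.exists_add_single`). A combinatorial lemma,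
`QuiverDim.exists_update_le`, ensures that the entries can be raised in such an order that the
kernel of `T` is never zero.
-/

/-! ### Intertwiners and isometries -/

namespace QuiverRep

section Intertwiners

variable {V : Type u} [Quiver.{v} V] {𝕜 : Type} [RCLike 𝕜]

/-- The intertwiners from `A` to `B` that also intertwine the adjoint matrices, that is, the
morphisms of `*`-representations. The second condition makes the adjoint of an intertwiner an
intertwiner. -/
def homSpace (A B : QuiverRep 𝕜 V) :
    Submodule 𝕜 (∀ i, Matrix (Fin (B.dim i)) (Fin (A.dim i)) 𝕜) where
  carrier := {S | ∀ (i j : V) (α : i ⟶ j), S j * A.mat α = B.mat α * S i ∧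
    S i * (A.mat α)ᴴ = (B.mat α)ᴴ * S j}
  add_mem' {S T} hS hT i j α := by
    simp only [Pi.add_apply, Matrix.add_mul, Matrix.mul_add, (hS i j α).1, (hT i j α).1,
      (hS i j α).2, (hT i j α).2, and_self]
  zero_mem' i j α := by simp
  smul_mem' c S hS i j α := by
    simp only [Pi.smul_apply, Matrix.smul_mul, Matrix.mul_smul, (hS i j α).1, (hS i j α).2,
      and_self]

variable {A B C : QuiverRep 𝕜 V}

theorem comp_mem_homSpace {T : ∀ i, Matrix (Fin (C.dim i)) (Fin (B.dim i)) 𝕜}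
    {S : ∀ i, Matrix (Fin (B.dim i)) (Fin (A.dim i)) 𝕜}
    (hT : T ∈ homSpace B C) (hS : S ∈ homSpace A B) :
    (fun i => T i * S i) ∈ homSpace A C := fun i j α => by
  constructor
  · rw [Matrix.mul_assoc, (hS i j α).1, ← Matrix.mul_assoc, (hT i j α).1, Matrix.mul_assoc]
  · rw [Matrix.mul_assoc, (hS i j α).2, ← Matrix.mul_assoc, (hT i j α).2, Matrix.mul_assoc]

theorem adjoint_mem_homSpace {S : ∀ i, Matrix (Fin (B.dim i)) (Fin (A.dim i)) 𝕜}
    (hS : S ∈ homSpace A B) : (fun i => (S i)ᴴ) ∈ homSpace B A := fun i j α => by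
  have h1 := congrArg conjTranspose (hS i j α).1
  have h2 := congrArg conjTranspose (hS i j α).2
  simp only [conjTranspose_mul, conjTranspose_conjTranspose] at h1 h2
  exact ⟨h2.symm, h1.symm⟩

/-- An isometry is an intertwiner of adjoints as well. -/
theorem mem_homSpace_of_unitary {S : ∀ i, Matrix (Fin (B.dim i)) (Fin (A.dim i)) 𝕜}
    (hU : ∀ i, (S i)ᴴ * S i = 1 ∧ S i * (S i)ᴴ = 1)
    (hS : ∀ (i j : V) (α : i ⟶ j), S j * A.mat α = B.mat α * S i) : S ∈ homSpace A B :=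
  fun i j α => by
  refine ⟨hS i j α, ?_⟩
  have h1 := congrArg conjTranspose (hS i j α)
  simp only [conjTranspose_mul] at h1
  calc S i * (A.mat α)ᴴ = S i * ((A.mat α)ᴴ * (S j)ᴴ) * S j := by
        rw [Matrix.mul_assoc, Matrix.mul_assoc, (hU j).1, Matrix.mul_one]
    _ = (B.mat α)ᴴ * S j := by
        rw [h1, ← Matrix.mul_assoc, (hU i).2, Matrix.one_mul]

theorem isometric_iff : A.Isometric B ↔ ∃ S ∈ homSpace A B,
    ∀ i, (S i)ᴴ * S i = 1 ∧ S i * (S i)ᴴ = 1 :=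
  ⟨fun ⟨S, hU, hS⟩ => ⟨S, mem_homSpace_of_unitary hU hS, hU⟩,
    fun ⟨S, hS, hU⟩ => ⟨S, hU, fun i j α => (hS i j α).1⟩⟩

theorem one_mem_homSpace (A : QuiverRep 𝕜 V) : (fun _ => 1) ∈ homSpace A A := fun i j α => by simp

theorem Isometric.refl (A : QuiverRep 𝕜 V) : A.Isometric A :=
  ⟨fun _ => 1, by simp, by simp⟩

theorem Isometric.symm (h : A.Isometric B) : B.Isometric A := by
  obtain ⟨S, hS, hU⟩ := isometric_iff.1 h
  exact isometric_iff.2 ⟨_, adjoint_mem_homSpace hS, fun i => by simpa using (hU i).symm⟩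

theorem Isometric.trans (h : A.Isometric B) (h' : B.Isometric C) : A.Isometric C := by
  obtain ⟨S, hS, hU⟩ := isometric_iff.1 h
  obtain ⟨T, hT, hW⟩ := isometric_iff.1 h'
  refine isometric_iff.2 ⟨_, comp_mem_homSpace hT hS, fun i => ?_⟩
  simp only [conjTranspose_mul]
  constructor
  · rw [Matrix.mul_assoc, ← Matrix.mul_assoc (T i)ᴴ, (hW i).1, Matrix.one_mul, (hU i).1]
  · rw [Matrix.mul_assoc, ← Matrix.mul_assoc (S i), (hU i).2, Matrix.one_mul, (hW i).2]

theorem Isometric.dim_eq (h : A.Isometric B) : A.dim = B.dim := by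
  obtain ⟨S, hU, -⟩ := h
  funext i
  have h1 := congrArg trace (hU i).1
  rw [trace_mul_comm, (hU i).2] at h1
  simp only [trace_one, Fintype.card_fin] at h1
  exact_mod_cast h1.symm

/-- A relabelling of the standard bases is an isometry. -/
theorem Isometric.of_equiv (e : ∀ i, Fin (A.dim i) ≃ Fin (B.dim i))
    (h : ∀ (i j : V) (α : i ⟶ j), (A.mat α) = (B.mat α).submatrix (e j) (e i)) :
    A.Isometric B := by
  refine ⟨fun i => (1 : Matrix (Fin (B.dim i)) (Fin (B.dim i)) 𝕜).submatrix id (e i),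
    fun i => ⟨?_, ?_⟩, fun i j α => ?_⟩
  · ext x y
    simp [mul_apply, one_apply]
  · rw [conjTranspose_submatrix, conjTranspose_one, submatrix_mul_equiv]
    simp
  · ext x y
    simp only [h, mul_apply, submatrix_apply, id_eq, one_apply, ite_mul, one_mul, zero_mul,
      mul_ite, mul_one, mul_zero, Finset.sum_ite_eq', Finset.mem_univ, if_true]
    exact ((e j).sum_comp fun z => if x = z then B.mat α z (e i y) else 0).trans (by simp)

end Intertwiners

/-! ### Orthogonal direct sums -/

section Blocks

variable {𝕜 : Type} [RCLike 𝕜] {m n m' n' : ℕ}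

variable (𝕜 m n) in
/-- The inclusion of the first coordinates. -/
def inclLeft : Matrix (Fin (m + n)) (Fin m) 𝕜 :=
  (fromRows 1 0 : Matrix (Fin m ⊕ Fin n) _ 𝕜).submatrix finSumFinEquiv.symm (Equiv.refl _)

variable (𝕜 m n) in
/-- The inclusion of the last coordinates. -/
def inclRight : Matrix (Fin (m + n)) (Fin n) 𝕜 :=
  (fromRows 0 1 : Matrix (Fin m ⊕ Fin n) _ 𝕜).submatrix finSumFinEquiv.symm (Equiv.refl _)

theorem inclLeft_adjoint_mul : (inclLeft 𝕜 m n)ᴴ * inclLeft 𝕜 m n = 1 := by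
  ext x y
  simp [inclLeft, mul_apply, Fin.sum_univ_add, one_apply, eq_comm]

theorem inclRight_adjoint_mul : (inclRight 𝕜 m n)ᴴ * inclRight 𝕜 m n = 1 := by
  ext x y
  simp [inclRight, mul_apply, Fin.sum_univ_add, one_apply, eq_comm]

theorem inclLeft_adjoint_mul_inclRight : (inclLeft 𝕜 m n)ᴴ * inclRight 𝕜 m n = 0 := by
  ext x y
  simp [inclRight, inclLeft, mul_apply, Fin.sum_univ_add, one_apply]

theorem incl_mul_adjoint :
    inclLeft 𝕜 m n * (inclLeft 𝕜 m n)ᴴ + inclRight 𝕜 m n * (inclRight 𝕜 m n)ᴴ = 1 := by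
  have h : fromRows (1 : Matrix (Fin m) (Fin m) 𝕜) (0 : Matrix (Fin n) _ 𝕜) *
        (fromRows (1 : Matrix (Fin m) (Fin m) 𝕜) (0 : Matrix (Fin n) _ 𝕜))ᴴ +
      fromRows (0 : Matrix (Fin m) _ 𝕜) (1 : Matrix (Fin n) (Fin n) 𝕜) *
        (fromRows (0 : Matrix (Fin m) _ 𝕜) (1 : Matrix (Fin n) (Fin n) 𝕜))ᴴ = 1 := by
    rw [conjTranspose_fromRows_eq_fromCols_conjTranspose,
      conjTranspose_fromRows_eq_fromCols_conjTranspose, fromRows_mul_fromCols,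
      fromRows_mul_fromCols, fromBlocks_add]
    simp [fromBlocks_one]
  simp only [inclLeft, inclRight, conjTranspose_submatrix, submatrix_mul_equiv]
  exact (congrArg (fun M => M.submatrix finSumFinEquiv.symm finSumFinEquiv.symm) h).trans
    (submatrix_one_equiv _)

theorem block_mul_inclLeft (A : Matrix (Fin m) (Fin n) 𝕜) (B : Matrix (Fin m') (Fin n') 𝕜) :
    reindex finSumFinEquiv finSumFinEquiv (fromBlocks A 0 0 B) * inclLeft 𝕜 n n' =
      inclLeft 𝕜 m m' * A := by
  ext x y
  induction x using Fin.addCases <;>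
  simp [inclLeft, mul_apply, one_apply, Fin.sum_univ_add]

theorem block_mul_inclRight (A : Matrix (Fin m) (Fin n) 𝕜) (B : Matrix (Fin m') (Fin n') 𝕜) :
    reindex finSumFinEquiv finSumFinEquiv (fromBlocks A 0 0 B) * inclRight 𝕜 n n' =
      inclRight 𝕜 m m' * B := by
  ext x y
  induction x using Fin.addCases <;>
  simp [inclRight, mul_apply, one_apply, Fin.sum_univ_add]

theorem block_conjTranspose (A : Matrix (Fin m) (Fin n) 𝕜) (B : Matrix (Fin m') (Fin n') 𝕜) :
    (reindex finSumFinEquiv finSumFinEquiv (fromBlocks A 0 0 B))ᴴ =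
      reindex finSumFinEquiv finSumFinEquiv (fromBlocks Aᴴ 0 0 Bᴴ) := by
  simp [conjTranspose_submatrix, fromBlocks_conjTranspose]

/-- The exchange of the first two blocks of `Fin (b + (c + d))`. -/
def blockSwap (b c d : ℕ) : Fin (b + (c + d)) ≃ Fin (c + (b + d)) :=
  finSumFinEquiv.symm.trans (((Equiv.refl _).sumCongr finSumFinEquiv.symm).trans
    ((Equiv.sumAssoc _ _ _).symm.trans (((Equiv.sumComm _ _).sumCongr (Equiv.refl _)).trans
      ((Equiv.sumAssoc _ _ _).trans (((Equiv.refl _).sumCongr finSumFinEquiv).trans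
        finSumFinEquiv)))))

theorem block_swap {b c d b' c' d' : ℕ} (B : Matrix (Fin b) (Fin b') 𝕜)
    (C : Matrix (Fin c) (Fin c') 𝕜) (D : Matrix (Fin d) (Fin d') 𝕜) :
    reindex finSumFinEquiv finSumFinEquiv (fromBlocks B 0 0
        (reindex finSumFinEquiv finSumFinEquiv (fromBlocks C 0 0 D))) =
      (reindex finSumFinEquiv finSumFinEquiv (fromBlocks C 0 0
        (reindex finSumFinEquiv finSumFinEquiv (fromBlocks B 0 0 D)))).submatrix
        (blockSwap b c d) (blockSwap b' c' d') := by
  ext x y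
  obtain ⟨x, rfl⟩ := finSumFinEquiv.surjective x
  obtain ⟨y, rfl⟩ := finSumFinEquiv.surjective y
  have key : ∀ {b c d : ℕ} {p : Fin b ⊕ Fin (c + d) → Prop},
      (∀ x, p (Sum.inl x)) → (∀ x, p (Sum.inr (finSumFinEquiv (Sum.inl x)))) →
      (∀ x, p (Sum.inr (finSumFinEquiv (Sum.inr x)))) → ∀ x, p x := by
    rintro b c d p h1 h2 h3 (x | x)
    · exact h1 x
    · obtain ⟨x | x, rfl⟩ := finSumFinEquiv.surjective x
      exacts [h2 x, h3 x]
  revert x y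
  refine key ?_ ?_ ?_ <;> intro x <;> refine key ?_ ?_ ?_ <;> intro y <;>
  simp [blockSwap, -finSumFinEquiv_apply_left, -finSumFinEquiv_apply_right]

end Blocks

section DirectSum

variable {V : Type u} [Quiver.{v} V] {𝕜 : Type} [RCLike 𝕜] {A B C D : QuiverRep 𝕜 V}

variable (B C) in
theorem inclLeft_mem_homSpace :
    (fun i => inclLeft 𝕜 (B.dim i) (C.dim i)) ∈ homSpace B (B.directSum C) := fun i j α => by
  constructor
  · exact (block_mul_inclLeft (B.mat α) (C.mat α)).symm
  · have := (block_mul_inclLeft (B.mat α)ᴴ (C.mat α)ᴴ).symm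
    rw [← block_conjTranspose] at this
    exact this

variable (B C) in
theorem inclRight_mem_homSpace :
    (fun i => inclRight 𝕜 (B.dim i) (C.dim i)) ∈ homSpace C (B.directSum C) := fun i j α => by
  constructor
  · exact (block_mul_inclRight (B.mat α) (C.mat α)).symm
  · have := (block_mul_inclRight (B.mat α)ᴴ (C.mat α)ᴴ).symm
    rw [← block_conjTranspose] at this
    exact this

/-- The two families are the isometric inclusions of complementary orthogonal summands `B` and `C`
of `D`. -/
structure IsOrthogonalSum (B C D : QuiverRep 𝕜 V)
    (S : ∀ i, Matrix (Fin (D.dim i)) (Fin (B.dim i)) 𝕜)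
    (T : ∀ i, Matrix (Fin (D.dim i)) (Fin (C.dim i)) 𝕜) : Prop where
  left_mem : S ∈ homSpace B D
  right_mem : T ∈ homSpace C D
  left_left (i) : (S i)ᴴ * S i = 1
  right_right (i) : (T i)ᴴ * T i = 1
  left_right (i) : (S i)ᴴ * T i = 0
  sum (i) : S i * (S i)ᴴ + T i * (T i)ᴴ = 1

variable (B C) in
theorem isOrthogonalSum_directSum : IsOrthogonalSum B C (B.directSum C)
    (fun i => inclLeft 𝕜 (B.dim i) (C.dim i)) (fun i => inclRight 𝕜 (B.dim i) (C.dim i)) where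
  left_mem := inclLeft_mem_homSpace B C
  right_mem := inclRight_mem_homSpace B C
  left_left _ := inclLeft_adjoint_mul
  right_right _ := inclRight_adjoint_mul
  left_right _ := inclLeft_adjoint_mul_inclRight
  sum _ := incl_mul_adjoint

namespace IsOrthogonalSum

variable {S : ∀ i, Matrix (Fin (D.dim i)) (Fin (B.dim i)) 𝕜}
    {T : ∀ i, Matrix (Fin (D.dim i)) (Fin (C.dim i)) 𝕜}

theorem right_left (h : IsOrthogonalSum B C D S T) (i : V) : (T i)ᴴ * S i = 0 := by
  simpa using congrArg conjTranspose (h.left_right i)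

/-- Two orthogonal sums of the same representations are isometric. -/
theorem isometric {D' : QuiverRep 𝕜 V} {S' : ∀ i, Matrix (Fin (D'.dim i)) (Fin (B.dim i)) 𝕜}
    {T' : ∀ i, Matrix (Fin (D'.dim i)) (Fin (C.dim i)) 𝕜} (h : IsOrthogonalSum B C D S T)
    (h' : IsOrthogonalSum B C D' S' T') : D.Isometric D' := by
  have key : ∀ {D D' : QuiverRep 𝕜 V} {S : ∀ i, Matrix (Fin (D.dim i)) (Fin (B.dim i)) 𝕜}
      {T : ∀ i, Matrix (Fin (D.dim i)) (Fin (C.dim i)) 𝕜}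
      {S' : ∀ i, Matrix (Fin (D'.dim i)) (Fin (B.dim i)) 𝕜}
      {T' : ∀ i, Matrix (Fin (D'.dim i)) (Fin (C.dim i)) 𝕜} (h : IsOrthogonalSum B C D S T)
      (h' : IsOrthogonalSum B C D' S' T') (i : V),
      (S i * (S' i)ᴴ + T i * (T' i)ᴴ) * (S' i * (S i)ᴴ + T' i * (T i)ᴴ) = 1 := by
    intro D D' S T S' T' h h' i
    have e1 : S i * (S' i)ᴴ * (S' i * (S i)ᴴ) = S i * (S i)ᴴ := by
      rw [Matrix.mul_assoc, ← Matrix.mul_assoc (S' i)ᴴ, h'.left_left, Matrix.one_mul]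
    have e2 : T i * (T' i)ᴴ * (T' i * (T i)ᴴ) = T i * (T i)ᴴ := by
      rw [Matrix.mul_assoc, ← Matrix.mul_assoc (T' i)ᴴ, h'.right_right, Matrix.one_mul]
    have e3 : S i * (S' i)ᴴ * (T' i * (T i)ᴴ) = 0 := by
      rw [Matrix.mul_assoc, ← Matrix.mul_assoc (S' i)ᴴ, h'.left_right, Matrix.zero_mul,
        Matrix.mul_zero]
    have e4 : T i * (T' i)ᴴ * (S' i * (S i)ᴴ) = 0 := by
      rw [Matrix.mul_assoc, ← Matrix.mul_assoc (T' i)ᴴ, h'.right_left, Matrix.zero_mul,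
        Matrix.mul_zero]
    rw [Matrix.add_mul, Matrix.mul_add, Matrix.mul_add, e1, e2, e3, e4, add_zero, zero_add, h.sum]
  refine isometric_iff.2 ⟨_, (homSpace D D').add_mem
    (comp_mem_homSpace h'.left_mem (adjoint_mem_homSpace h.left_mem))
    (comp_mem_homSpace h'.right_mem (adjoint_mem_homSpace h.right_mem)), fun i => ?_⟩
  simp only [Pi.add_apply, conjTranspose_add, conjTranspose_mul, conjTranspose_conjTranspose]
  exact ⟨key h h' i, key h' h i⟩

theorem isometric_directSum (h : IsOrthogonalSum B C D S T) : D.Isometric (B.directSum C) :=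
  h.isometric (isOrthogonalSum_directSum B C)

theorem comp_isometry (h : IsOrthogonalSum B C D S T) {B' C' D' : QuiverRep 𝕜 V}
    {Q : ∀ i, Matrix (Fin (B.dim i)) (Fin (B'.dim i)) 𝕜} (hQ : Q ∈ homSpace B' B)
    (hQU : ∀ i, (Q i)ᴴ * Q i = 1 ∧ Q i * (Q i)ᴴ = 1)
    {R : ∀ i, Matrix (Fin (C.dim i)) (Fin (C'.dim i)) 𝕜} (hR : R ∈ homSpace C' C)
    (hRU : ∀ i, (R i)ᴴ * R i = 1 ∧ R i * (R i)ᴴ = 1)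
    {U : ∀ i, Matrix (Fin (D'.dim i)) (Fin (D.dim i)) 𝕜} (hU : U ∈ homSpace D D')
    (hUU : ∀ i, (U i)ᴴ * U i = 1 ∧ U i * (U i)ᴴ = 1) :
    IsOrthogonalSum B' C' D' (fun i => U i * (S i * Q i)) (fun i => U i * (T i * R i)) where
  left_mem := comp_mem_homSpace hU (comp_mem_homSpace h.left_mem hQ)
  right_mem := comp_mem_homSpace hU (comp_mem_homSpace h.right_mem hR)
  left_left i := by
    rw [conjTranspose_mul, Matrix.mul_assoc, ← Matrix.mul_assoc (U i)ᴴ, (hUU i).1, Matrix.one_mul,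
      conjTranspose_mul, Matrix.mul_assoc, ← Matrix.mul_assoc (S i)ᴴ, h.left_left, Matrix.one_mul,
      (hQU i).1]
  right_right i := by
    rw [conjTranspose_mul, Matrix.mul_assoc, ← Matrix.mul_assoc (U i)ᴴ, (hUU i).1, Matrix.one_mul,
      conjTranspose_mul, Matrix.mul_assoc, ← Matrix.mul_assoc (T i)ᴴ, h.right_right,
      Matrix.one_mul, (hRU i).1]
  left_right i := by
    rw [conjTranspose_mul, Matrix.mul_assoc, ← Matrix.mul_assoc (U i)ᴴ, (hUU i).1, Matrix.one_mul,
      conjTranspose_mul, Matrix.mul_assoc, ← Matrix.mul_assoc (S i)ᴴ, h.left_right,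
      Matrix.zero_mul, Matrix.mul_zero]
  sum i := by
    have e1 : U i * (S i * Q i) * (U i * (S i * Q i))ᴴ = U i * (S i * (S i)ᴴ) * (U i)ᴴ := by
      simp only [conjTranspose_mul, Matrix.mul_assoc]
      rw [← Matrix.mul_assoc (Q i), (hQU i).2, Matrix.one_mul]
    have e2 : U i * (T i * R i) * (U i * (T i * R i))ᴴ = U i * (T i * (T i)ᴴ) * (U i)ᴴ := by
      simp only [conjTranspose_mul, Matrix.mul_assoc]
      rw [← Matrix.mul_assoc (R i), (hRU i).2, Matrix.one_mul]
    rw [e1, e2, ← Matrix.add_mul, ← Matrix.mul_add, h.sum, Matrix.mul_one, (hUU i).2]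

end IsOrthogonalSum

theorem exists_isOrthogonalSum (h : D.Isometric (B.directSum C)) :
    ∃ S T, IsOrthogonalSum B C D S T := by
  obtain ⟨U, hU, hUU⟩ := isometric_iff.1 h.symm
  exact ⟨_, _, (isOrthogonalSum_directSum B C).comp_isometry (one_mem_homSpace B) (by simp)
    (one_mem_homSpace C) (by simp) hU hUU⟩

theorem Isometric.directSum {B' C' : QuiverRep 𝕜 V} (hB : B.Isometric B') (hC : C.Isometric C') :
    (B.directSum C).Isometric (B'.directSum C') := by
  obtain ⟨Q, hQ, hQU⟩ := isometric_iff.1 hB.symm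
  obtain ⟨R, hR, hRU⟩ := isometric_iff.1 hC.symm
  exact ((isOrthogonalSum_directSum B C).comp_isometry hQ hQU hR hRU
    (one_mem_homSpace _) (by simp)).isometric_directSum

variable (B C D) in
theorem directSum_left_comm :
    (B.directSum (C.directSum D)).Isometric (C.directSum (B.directSum D)) :=
  Isometric.of_equiv (fun i => blockSwap (B.dim i) (C.dim i) (D.dim i))
    fun _ _ α => block_swap (B.mat α) (C.mat α) (D.mat α)

end DirectSum

end QuiverRep

/-! ### Spectral decomposition and Schur's lemma -/

namespace QuiverRep

section Spectral

variable {𝕜 : Type} [RCLike 𝕜]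

/-- The columns of a unitary matrix selected by `p` form an isometry onto a spectral subspace. -/
theorem exists_isometry_of_unitary {d : ℕ} {U : Matrix (Fin d) (Fin d) 𝕜} (hU : Uᴴ * U = 1)
    (p : Fin d → Prop) [DecidablePred p] :
    ∃ S : Matrix (Fin d) (Fin (Fintype.card {k // p k})) 𝕜, Sᴴ * S = 1 ∧
      S * Sᴴ = U * diagonal (fun k => if p k then 1 else 0) * Uᴴ := by
  let e := (Fintype.equivFin {k // p k}).symm
  refine ⟨U.submatrix id (fun k => (e k).1), ?_, ?_⟩
  · rw [conjTranspose_submatrix, ← submatrix_mul _ _ _ _ _ Function.bijective_id, hU]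
    exact submatrix_one _ (Subtype.val_injective.comp e.injective)
  · ext x y
    rw [mul_apply, mul_apply]
    simp only [conjTranspose_apply, submatrix_apply, id_eq, mul_diagonal, mul_ite, mul_one,
      mul_zero, ite_mul, zero_mul]
    rw [← Finset.sum_filter, ← Finset.sum_subtype_eq_sum_filter]
    simp only [Finset.subtype_univ]
    exact e.sum_comp fun k => U x k * star (U y k)

/-- Matrices intertwining two diagonalized Hermitian matrices intertwine functions of them. This
needs no polynomial interpolation: in eigenbases the condition says that an entry vanishes unless
it relates equal eigenvalues. -/
theorem diagonal_intertwine {m n : ℕ} {U : Matrix (Fin m) (Fin m) 𝕜} {W : Matrix (Fin n) (Fin n) 𝕜}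
    (hU : Uᴴ * U = 1) (hW : Wᴴ * W = 1) (hU' : U * Uᴴ = 1) (hW' : W * Wᴴ = 1)
    {a : Fin m → ℝ} {b : Fin n → ℝ} {M : Matrix (Fin m) (Fin n) 𝕜}
    (hM : U * diagonal (fun k => (a k : 𝕜)) * Uᴴ * M = M * (W * diagonal (fun k => (b k : 𝕜)) * Wᴴ))
    (f : ℝ → 𝕜) :
    U * diagonal (fun k => f (a k)) * Uᴴ * M = M * (W * diagonal (fun k => f (b k)) * Wᴴ) := by
  have key : diagonal (fun k => (a k : 𝕜)) * (Uᴴ * M * W) =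
      (Uᴴ * M * W) * diagonal (fun k => (b k : 𝕜)) := by
    have h := congrArg (fun X => Uᴴ * X * W) hM
    simp only [Matrix.mul_assoc] at h ⊢
    rw [hW, Matrix.mul_one, ← Matrix.mul_assoc Uᴴ U, hU, Matrix.one_mul] at h
    exact h
  have key2 : diagonal (fun k => f (a k)) * (Uᴴ * M * W) =
      (Uᴴ * M * W) * diagonal (fun k => f (b k)) := by
    ext x y
    have h := congrFun (congrFun key x) y
    rw [diagonal_mul, mul_diagonal] at h
    rw [diagonal_mul, mul_diagonal]
    by_cases h0 : (Uᴴ * M * W) x y = 0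
    · simp [h0]
    · rw [mul_comm, mul_right_inj' h0] at h
      rw [RCLike.ofReal_injective h, mul_comm]
  have h := congrArg (fun X => U * X * Wᴴ) key2
  simp only [Matrix.mul_assoc] at h ⊢
  rw [hW', Matrix.mul_one, ← Matrix.mul_assoc U Uᴴ, hU', Matrix.one_mul] at h
  exact h

end Spectral

section Schur

variable {V : Type u} [Quiver.{v} V] {𝕜 : Type} [RCLike 𝕜] {A B C D : QuiverRep 𝕜 V}

/-- A family of matrices indexed by the arrows, on arbitrary finite index sets, is *Schurian* if
only scalars are Hermitian families commuting with it. Arbitrary index sets allow families that are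
built from blocks. -/
def IsSchurian {X : V → Type} [∀ k, Fintype (X k)] [∀ k, DecidableEq (X k)]
    (M : ∀ k l : V, (k ⟶ l) → Matrix (X l) (X k) 𝕜) : Prop :=
  ∀ H : ∀ k, Matrix (X k) (X k) 𝕜, (∀ k, (H k).IsHermitian) →
    (∀ (k l : V) (α : k ⟶ l), H l * M k l α = M k l α * H k) → ∃ c : 𝕜, ∀ k, H k = c • 1

theorem mem_homSpace_of_isHermitian {H : ∀ k, Matrix (Fin (A.dim k)) (Fin (A.dim k)) 𝕜}
    (hH : ∀ k, (H k).IsHermitian)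
    (hA : ∀ (k l : V) (α : k ⟶ l), H l * A.mat α = A.mat α * H k) : H ∈ homSpace A A := by
  refine fun i j α => ⟨hA i j α, ?_⟩
  have h := congrArg conjTranspose (hA i j α)
  rw [conjTranspose_mul, conjTranspose_mul, (hH i).eq, (hH j).eq] at h
  exact h.symm

theorem eq_zero_of_smul_one_eq_zero {n : ℕ} {c : 𝕜} (hn : n ≠ 0)
    (h : c • (1 : Matrix (Fin n) (Fin n) 𝕜) = 0) : c = 0 := by
  have := congrFun (congrFun h ⟨0, Nat.pos_of_ne_zero hn⟩) ⟨0, Nat.pos_of_ne_zero hn⟩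
  simpa using this

/-- A representation with non-scalar Hermitian endomorphisms splits along an eigenspace. -/
theorem Indecomposable.isSchurian (hA : A.Indecomposable) :
    IsSchurian (fun _ _ α => A.mat α) := by
  intro H hH hc
  obtain ⟨i₀, hi₀⟩ := Function.ne_iff.1 hA.1
  let k₀ : Fin (A.dim i₀) := ⟨0, Nat.pos_of_ne_zero hi₀⟩
  let μ := (hH i₀).eigenvalues k₀
  have hU : ∀ i, (hH i).eigenvectorUnitary.1ᴴ * (hH i).eigenvectorUnitary.1 = 1 :=
    fun i => Unitary.coe_star_mul_self _
  have hU' : ∀ i, (hH i).eigenvectorUnitary.1 *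
      (hH i).eigenvectorUnitary.1ᴴ = 1 := fun i => Unitary.coe_mul_star_self _
  -- `S` embeds the eigenspaces for `μ`, and `T` their orthogonal complements.
  choose S hS1 hS2 using fun i =>
    exists_isometry_of_unitary (hU i) (fun k => (hH i).eigenvalues k = μ)
  choose T hT1 hT2 using fun i =>
    exists_isometry_of_unitary (hU i) (fun k => ¬ (hH i).eigenvalues k = μ)
  have hsum : ∀ i, S i * (S i)ᴴ + T i * (T i)ᴴ = 1 := by
    intro i
    rw [hS2, hT2, ← Matrix.add_mul, ← Matrix.mul_add, diagonal_add]
    have : (fun k => (if (hH i).eigenvalues k = μ then (1 : 𝕜) else 0) +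
        (if ¬ (hH i).eigenvalues k = μ then 1 else 0)) = fun _ => 1 := by
      funext k; split_ifs <;> simp
    rw [this, diagonal_one, Matrix.mul_one, hU']
  have hST : ∀ i, (S i)ᴴ * T i = 0 := by
    intro i
    have h := congrArg (fun X => (S i)ᴴ * X * T i) (hsum i)
    simp only [Matrix.mul_add, Matrix.add_mul, Matrix.mul_one] at h
    rw [← Matrix.mul_assoc, hS1, Matrix.one_mul, Matrix.mul_assoc, Matrix.mul_assoc, hT1,
      Matrix.mul_one] at h
    simpa using h
  have hPS : ∀ (i j : V) (α : i ⟶ j), S j * (S j)ᴴ * A.mat α = A.mat α * (S i * (S i)ᴴ) := by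
    intro i j α
    rw [hS2, hS2]
    refine diagonal_intertwine (hU j) (hU i) (hU' j) (hU' i) ?_
      fun x => if x = μ then (1 : 𝕜) else 0
    have sj := (hH j).spectral_theorem
    have si := (hH i).spectral_theorem
    rw [Unitary.conjStarAlgAut_apply, star_eq_conjTranspose] at si sj
    have h := hc i j α
    rw [si, sj] at h
    exact h
  have hPT : ∀ (i j : V) (α : i ⟶ j), T j * (T j)ᴴ * A.mat α = A.mat α * (T i * (T i)ᴴ) := by
    intro i j α
    rw [← sub_eq_iff_eq_add'.2 (hsum i).symm, ← sub_eq_iff_eq_add'.2 (hsum j).symm, Matrix.sub_mul,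
      Matrix.mul_sub, hPS, Matrix.one_mul, Matrix.mul_one]
  -- Both families of subspaces are invariant, so `A` is the sum of its compressions to them.
  let compress : ∀ (b : V → ℕ) (_ : ∀ i, Matrix (Fin (A.dim i)) (Fin (b i)) 𝕜), QuiverRep 𝕜 V :=
    fun b S => ⟨b, fun {i j} α => (S j)ᴴ * A.mat α * S i⟩
  have mem : ∀ (b : V → ℕ) (S : ∀ i, Matrix (Fin (A.dim i)) (Fin (b i)) 𝕜),
      (∀ i, (S i)ᴴ * S i = 1) →
      (∀ (i j : V) (α : i ⟶ j), S j * (S j)ᴴ * A.mat α = A.mat α * (S i * (S i)ᴴ)) →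
      S ∈ homSpace (compress b S) A := by
    intro b S h1 h2 i j α
    constructor
    · change S j * ((S j)ᴴ * A.mat α * S i) = _
      rw [← Matrix.mul_assoc, ← Matrix.mul_assoc, h2, Matrix.mul_assoc, Matrix.mul_assoc, h1,
        Matrix.mul_one]
    · change S i * ((S j)ᴴ * A.mat α * S i)ᴴ = _
      have h3 := congrArg conjTranspose (h2 i j α)
      simp only [conjTranspose_mul, conjTranspose_conjTranspose] at h3 ⊢
      rw [← Matrix.mul_assoc (S i), ← Matrix.mul_assoc, ← h3, Matrix.mul_assoc, Matrix.mul_assoc,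
        h1, Matrix.mul_one]
  have hsplit : IsOrthogonalSum (compress _ S) (compress _ T) A S T :=
    ⟨mem _ S hS1 hPS, mem _ T hT1 hPT, hS1, hT1, hST, hsum⟩
  -- The first summand is nonzero at `i₀`, so the second vanishes and `μ` is the only eigenvalue.
  have hne : ∀ i, Fintype.card {k // ¬ (hH i).eigenvalues k = μ} = 0 := by
    rcases hA.2 _ _ hsplit.isometric_directSum with h | h
    · have h' := congrFun h i₀
      have : Fintype.card {k // (hH i₀).eigenvalues k = μ} = 0 := h'
      exact ((Fintype.card_eq_zero_iff.1 this).false ⟨k₀, rfl⟩).elim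
    · exact fun i => congrFun h i
  refine ⟨(μ : 𝕜), fun i => ?_⟩
  have hev : (RCLike.ofReal ∘ (hH i).eigenvalues : Fin (A.dim i) → 𝕜) = fun _ => (μ : 𝕜) := by
    funext k
    by_contra h
    exact (Fintype.card_eq_zero_iff.1 (hne i)).false ⟨k, fun h' => h (by simp [h'])⟩
  have s := (hH i).spectral_theorem
  rw [Unitary.conjStarAlgAut_apply, star_eq_conjTranspose, hev, ← smul_one_eq_diagonal] at s
  rw [s, Matrix.mul_smul, Matrix.mul_one, Matrix.smul_mul, hU']

/-- Indecomposability is the absence of non-scalar Hermitian endomorphisms. -/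
theorem indecomposable_iff : A.Indecomposable ↔
    A.dim ≠ 0 ∧ IsSchurian (fun _ _ α => A.mat α) := by
  refine ⟨fun h => ⟨h.1, h.isSchurian⟩, fun ⟨h0, h⟩ => ⟨h0, fun B C hBC => ?_⟩⟩
  obtain ⟨S, T, hST⟩ := exists_isOrthogonalSum hBC
  obtain ⟨c, hc⟩ := h (fun i => S i * (S i)ᴴ) (fun i => isHermitian_mul_conjTranspose_self _)
    fun i j α => (comp_mem_homSpace hST.left_mem (adjoint_mem_homSpace hST.left_mem) i j α).1
  by_contra! hne
  obtain ⟨i, hi⟩ := Function.ne_iff.1 hne.1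
  obtain ⟨j, hj⟩ := Function.ne_iff.1 hne.2
  have h1 : (c - 1) • (1 : Matrix (Fin (B.dim i)) (Fin (B.dim i)) 𝕜) = 0 := by
    have := congrArg (fun X => (S i)ᴴ * X * S i) (hc i)
    simp only [Matrix.mul_smul, Matrix.smul_mul, Matrix.mul_one] at this
    rw [← Matrix.mul_assoc, hST.left_left, Matrix.one_mul, hST.left_left] at this
    rw [sub_smul, ← this, one_smul, sub_self]
  have h2 : c • (1 : Matrix (Fin (C.dim j)) (Fin (C.dim j)) 𝕜) = 0 := by
    have := congrArg (fun X => (T j)ᴴ * X * T j) (hc j)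
    simp only [Matrix.mul_smul, Matrix.smul_mul, Matrix.mul_one] at this
    rw [← Matrix.mul_assoc, hST.right_left, Matrix.zero_mul, Matrix.zero_mul,
      hST.right_right] at this
    exact this.symm
  have h1 := eq_zero_of_smul_one_eq_zero hi h1
  rw [eq_zero_of_smul_one_eq_zero hj h2] at h1
  simp at h1

/-- A nonzero intertwiner out of an indecomposable representation is a multiple of an isometric
embedding: `Sᴴ * S` is a Hermitian endomorphism, so a positive scalar. -/
theorem Indecomposable.exists_isometry (hA : A.Indecomposable) (hAB : homSpace A B ≠ ⊥) :
    ∃ S ∈ homSpace A B, ∀ i, (S i)ᴴ * S i = 1 := by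
  obtain ⟨S, hS, hS0⟩ := Submodule.exists_mem_ne_zero_of_ne_bot hAB
  obtain ⟨c, hc⟩ := hA.isSchurian (fun i => (S i)ᴴ * S i)
    (fun i => isHermitian_conjTranspose_mul_self _)
    fun i j α => (comp_mem_homSpace (adjoint_mem_homSpace hS) hS i j α).1
  obtain ⟨i, hi⟩ := Function.ne_iff.1 hS0
  obtain ⟨x, y, hxy⟩ : ∃ x y, S i x y ≠ 0 := by
    by_contra! h
    exact hi (by ext x y; exact h x y)
  have hcr : c = ((∑ z, ‖S i z y‖ ^ 2 : ℝ) : 𝕜) := by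
    have h := congrFun (congrFun (hc i) y) y
    simp only [mul_apply, conjTranspose_apply, Matrix.smul_apply, one_apply_eq, smul_eq_mul,
      mul_one] at h
    rw [← h, RCLike.ofReal_sum]
    refine Finset.sum_congr rfl fun z _ => ?_
    rw [RCLike.star_def, RCLike.conj_mul]
    simp
  have hr : 0 < ∑ z, ‖S i z y‖ ^ 2 :=
    Finset.sum_pos' (fun z _ => by positivity) ⟨x, Finset.mem_univ _, by positivity⟩
  set r := ∑ z, ‖S i z y‖ ^ 2
  have hrr : ((Real.sqrt r)⁻¹ : ℝ) * (Real.sqrt r)⁻¹ * r = 1 := by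
    rw [← mul_inv, Real.mul_self_sqrt hr.le, inv_mul_cancel₀ hr.ne']
  refine ⟨(((Real.sqrt r)⁻¹ : ℝ) : 𝕜) • S, (homSpace A B).smul_mem _ hS, fun j => ?_⟩
  rw [Pi.smul_apply, conjTranspose_smul, Matrix.smul_mul, Matrix.mul_smul, hc j, hcr, smul_smul,
    smul_smul, RCLike.star_def, RCLike.conj_ofReal, ← RCLike.ofReal_mul, ← RCLike.ofReal_mul,
    hrr, RCLike.ofReal_one, one_smul]

theorem Indecomposable.isometric_of_isometry (hA : A.Indecomposable) (hB : B.Indecomposable)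
    {S : ∀ i, Matrix (Fin (B.dim i)) (Fin (A.dim i)) 𝕜} (hS : S ∈ homSpace A B)
    (hSU : ∀ i, (S i)ᴴ * S i = 1) : A.Isometric B := by
  obtain ⟨c, hc⟩ := hB.isSchurian (fun i => S i * (S i)ᴴ)
    (fun i => isHermitian_mul_conjTranspose_self _)
    fun i j α => (comp_mem_homSpace hS (adjoint_mem_homSpace hS) i j α).1
  obtain ⟨i, hi⟩ := Function.ne_iff.1 hA.1
  have h1 : (c - 1) • (1 : Matrix (Fin (A.dim i)) (Fin (A.dim i)) 𝕜) = 0 := by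
    have := congrArg (fun X => (S i)ᴴ * X * S i) (hc i)
    simp only [Matrix.mul_smul, Matrix.smul_mul, Matrix.mul_one] at this
    rw [← Matrix.mul_assoc, hSU, Matrix.one_mul, hSU] at this
    rw [sub_smul, ← this, one_smul, sub_self]
  have h1 := sub_eq_zero.1 (eq_zero_of_smul_one_eq_zero hi h1)
  refine isometric_iff.2 ⟨S, hS, fun j => ⟨hSU j, ?_⟩⟩
  rw [hc j, h1, one_smul]

/-- **Schur's lemma**: indecomposable representations with a nonzero intertwiner are isometric. -/
theorem Indecomposable.isometric (hA : A.Indecomposable) (hB : B.Indecomposable)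
    (hAB : homSpace A B ≠ ⊥) : A.Isometric B := by
  obtain ⟨S, hS, hSU⟩ := hA.exists_isometry hAB
  exact hA.isometric_of_isometry hB hS hSU

end Schur

end QuiverRep

/-! ### Dimensions of intertwiner spaces and unique decomposition -/

namespace QuiverRep

section HomDim

variable {V : Type u} [Quiver.{v} V] {𝕜 : Type} [RCLike 𝕜] {A B C D X : QuiverRep 𝕜 V}

/-- The dimension over `𝕜` of the space of intertwiners. -/
noncomputable def homDim (A B : QuiverRep 𝕜 V) : ℕ := Module.finrank 𝕜 (homSpace A B)

theorem IsOrthogonalSum.symm {S : ∀ i, Matrix (Fin (D.dim i)) (Fin (B.dim i)) 𝕜}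
    {T : ∀ i, Matrix (Fin (D.dim i)) (Fin (C.dim i)) 𝕜} (h : IsOrthogonalSum B C D S T) :
    IsOrthogonalSum C B D T S :=
  ⟨h.right_mem, h.left_mem, h.right_right, h.left_left, h.right_left,
    fun i => (add_comm _ _).trans (h.sum i)⟩

variable (B C) in
theorem directSum_comm : (B.directSum C).Isometric (C.directSum B) :=
  (isOrthogonalSum_directSum B C).symm.isometric_directSum

variable (B C D) in
theorem directSum_assoc :
    ((B.directSum C).directSum D).Isometric (B.directSum (C.directSum D)) :=
  (directSum_comm _ _).trans ((directSum_left_comm _ _ _).trans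
    ((Isometric.refl B).directSum (directSum_comm _ _)))

/-- An isometry exhibits its target as an orthogonal sum with the zero representation. -/
theorem isOrthogonalSum_zeroRep {S : ∀ i, Matrix (Fin (D.dim i)) (Fin (B.dim i)) 𝕜}
    (hS : S ∈ homSpace B D) (hU : ∀ i, (S i)ᴴ * S i = 1 ∧ S i * (S i)ᴴ = 1) :
    IsOrthogonalSum B zeroRep D S (fun _ => 0) where
  left_mem := hS
  right_mem := (homSpace zeroRep D).zero_mem
  left_left i := (hU i).1
  right_right _ := by ext x; exact x.elim0
  left_right i := Matrix.mul_zero _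
  sum i := by rw [Matrix.zero_mul, add_zero, (hU i).2]

variable (A) in
theorem isometric_directSum_zeroRep : A.Isometric (A.directSum zeroRep) :=
  (isOrthogonalSum_zeroRep (one_mem_homSpace A) (by simp)).isometric_directSum

theorem isometric_zeroRep (hA : A.dim = 0) : A.Isometric zeroRep := by
  have h : ∀ i, IsEmpty (Fin (A.dim i)) := fun i => by
    rw [hA]; exact inferInstanceAs (IsEmpty (Fin 0))
  refine ⟨fun i => 0, fun i => ⟨?_, ?_⟩, fun i j α => ?_⟩
  · ext x; exact (h i).elim x
  · ext x; exact x.elim0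
  · ext x; exact x.elim0

theorem homDim_zeroRep : homDim X (zeroRep : QuiverRep 𝕜 V) = 0 := by
  have : Subsingleton (homSpace X (zeroRep : QuiverRep 𝕜 V)) :=
    ⟨fun S T => Subtype.ext (by funext i; ext x; exact x.elim0)⟩
  exact Module.finrank_zero_of_subsingleton

theorem listSum_append (L L' : List (QuiverRep 𝕜 V)) :
    (listSum (L ++ L')).Isometric ((listSum L).directSum (listSum L')) := by
  induction L with
  | nil => exact (isometric_directSum_zeroRep _).trans (directSum_comm _ _)
  | cons B L ih => exact ((Isometric.refl B).directSum ih).trans (directSum_assoc _ _ _).symm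

theorem listSum_isometric_of_perm {L L' : List (QuiverRep 𝕜 V)} (h : L.Perm L') :
    (listSum L).Isometric (listSum L') := by
  induction h with
  | nil => exact Isometric.refl _
  | cons B _ ih => exact (Isometric.refl B).directSum ih
  | swap B C L => exact directSum_left_comm _ _ _
  | trans _ _ h1 h2 => exact h1.trans h2

theorem listSum_isometric_of_forall₂ {L L' : List (QuiverRep 𝕜 V)}
    (h : List.Forall₂ Isometric L L') : (listSum L).Isometric (listSum L') := by
  induction h with
  | nil => exact Isometric.refl _
  | cons h1 _ ih => exact h1.directSum ih

variable [Finite V]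

theorem homDim_pos_iff : 0 < homDim A B ↔ homSpace A B ≠ ⊥ := by
  rw [homDim, Module.finrank_pos_iff, Submodule.nontrivial_iff_ne_bot]

theorem Indecomposable.homDim_self_pos (hA : A.Indecomposable) : 0 < homDim A A := by
  refine homDim_pos_iff.2 fun h => ?_
  obtain ⟨i, hi⟩ := Function.ne_iff.1 hA.1
  have h1 : (fun _ => 1) ∈ homSpace A A := one_mem_homSpace A
  rw [h, Submodule.mem_bot] at h1
  have h2 := congrFun h1 i
  exact one_ne_zero (eq_zero_of_smul_one_eq_zero (𝕜 := 𝕜) hi (by rw [one_smul]; exact h2))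

/-- The dimension of the intertwiner space is additive in its target. -/
theorem IsOrthogonalSum.homDim_eq {S : ∀ i, Matrix (Fin (D.dim i)) (Fin (B.dim i)) 𝕜}
    {T : ∀ i, Matrix (Fin (D.dim i)) (Fin (C.dim i)) 𝕜} (h : IsOrthogonalSum B C D S T)
    (X : QuiverRep 𝕜 V) : homDim X D = homDim X B + homDim X C := by
  have e : homSpace X D ≃ₗ[𝕜] homSpace X B × homSpace X C :=
    { toFun := fun R => (⟨_, comp_mem_homSpace (adjoint_mem_homSpace h.left_mem) R.2⟩,
        ⟨_, comp_mem_homSpace (adjoint_mem_homSpace h.right_mem) R.2⟩)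
      invFun := fun R => ⟨_, (homSpace X D).add_mem (comp_mem_homSpace h.left_mem R.1.2)
        (comp_mem_homSpace h.right_mem R.2.2)⟩
      map_add' := fun P Q => by
        refine Prod.ext (Subtype.ext ?_) (Subtype.ext ?_) <;> funext i <;>
        exact Matrix.mul_add _ _ _
      map_smul' := fun c P => by
        refine Prod.ext (Subtype.ext (funext fun i => ?_)) (Subtype.ext (funext fun i => ?_))
        · exact Matrix.mul_smul (S i)ᴴ c (P.1 i)
        · exact Matrix.mul_smul (T i)ᴴ c (P.1 i)
      left_inv := fun R => by
        refine Subtype.ext (funext fun i => ?_)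
        change S i * ((S i)ᴴ * R.1 i) + T i * ((T i)ᴴ * R.1 i) = R.1 i
        rw [← Matrix.mul_assoc, ← Matrix.mul_assoc, ← Matrix.add_mul, h.sum, Matrix.one_mul]
      right_inv := fun R => by
        refine Prod.ext (Subtype.ext ?_) (Subtype.ext ?_) <;> funext i
        · change (S i)ᴴ * (S i * R.1.1 i + T i * R.2.1 i) = R.1.1 i
          rw [Matrix.mul_add, ← Matrix.mul_assoc, ← Matrix.mul_assoc, h.left_left, h.left_right,
            Matrix.one_mul, Matrix.zero_mul, add_zero]
        · change (T i)ᴴ * (S i * R.1.1 i + T i * R.2.1 i) = R.2.1 i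
          rw [Matrix.mul_add, ← Matrix.mul_assoc, ← Matrix.mul_assoc, h.right_left, h.right_right,
            Matrix.one_mul, Matrix.zero_mul, zero_add] }
  rw [homDim, e.finrank_eq, Module.finrank_prod]
  rfl

theorem Isometric.homDim_eq (h : A.Isometric B) (X : QuiverRep 𝕜 V) :
    homDim X A = homDim X B := by
  obtain ⟨S, hS, hU⟩ := isometric_iff.1 h
  rw [(isOrthogonalSum_zeroRep hS hU).homDim_eq X, homDim_zeroRep, add_zero]

theorem homDim_listSum (X : QuiverRep 𝕜 V) (L : List (QuiverRep 𝕜 V)) :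
    homDim X (listSum L) = (L.map (homDim X)).sum := by
  induction L with
  | nil => exact homDim_zeroRep
  | cons B L ih =>
    rw [List.map_cons, List.sum_cons, ← ih]
    exact (isOrthogonalSum_directSum B (listSum L)).homDim_eq X

/-- The indecomposable summands are determined by the dimensions of intertwiner spaces: a summand
`B'` of the second list admits a nonzero intertwiner to the first sum, so by Schur's lemma it is
isometric to a summand there, and both can be cancelled. -/
theorem exists_perm_forall₂ {L L' : List (QuiverRep 𝕜 V)} (hL : ∀ B ∈ L, B.Indecomposable)
    (hL' : ∀ B ∈ L', B.Indecomposable)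
    (h : ∀ X : QuiverRep 𝕜 V, homDim X (listSum L) = homDim X (listSum L')) :
    ∃ L'', L.Perm L'' ∧ List.Forall₂ Isometric L'' L' := by
  induction L' generalizing L with
  | nil =>
    rcases L with _ | ⟨B, L⟩
    · exact ⟨[], .nil, .nil⟩
    · have hB := (hL B (by simp)).homDim_self_pos
      have h1 := h B
      rw [homDim_listSum, homDim_listSum, List.map_cons, List.sum_cons, List.map_nil,
        List.sum_nil] at h1
      omega
  | cons B' L' ih =>
    have hB' := hL' B' (by simp)
    obtain ⟨B, hB, hBB'⟩ : ∃ B ∈ L, B.Isometric B' := by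
      by_contra! hne
      have h0 : (L.map (homDim B')).sum = 0 := by
        refine List.sum_eq_zero fun n hn => ?_
        obtain ⟨B, hB, rfl⟩ := List.mem_map.1 hn
        by_contra h1
        exact hne B hB (hB'.isometric (hL B hB)
          (homDim_pos_iff.1 (Nat.pos_of_ne_zero h1))).symm
      have h1 := h B'
      rw [homDim_listSum, homDim_listSum, h0, List.map_cons, List.sum_cons] at h1
      have := hB'.homDim_self_pos
      omega
    obtain ⟨s, t, rfl⟩ := List.append_of_mem hB
    obtain ⟨L'', hp, hf⟩ := ih (L := s ++ t)
      (fun C hC => hL C (List.mem_append.2 ((List.mem_append.1 hC).imp_right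
        (List.mem_cons_of_mem _))))
      (fun C hC => hL' C (List.mem_cons_of_mem _ hC)) fun X => by
        have h1 := h X
        rw [(listSum_isometric_of_perm List.perm_middle).homDim_eq X, homDim_listSum,
          homDim_listSum, List.map_cons, List.map_cons, List.sum_cons, List.sum_cons,
          hBB'.homDim_eq X] at h1
        rw [homDim_listSum, homDim_listSum]
        omega
    exact ⟨B :: L'', List.perm_middle.trans (hp.cons B), .cons hBB' hf⟩

end HomDim

section Decomposition

variable {V : Type u} [Quiver.{v} V] [Fintype V] {𝕜 : Type} [RCLike 𝕜]

/-- Every representation is an orthogonal sum of indecomposable representations. -/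
theorem exists_listSum (A : QuiverRep 𝕜 V) : ∃ L : List (QuiverRep 𝕜 V),
    (∀ B ∈ L, B.Indecomposable) ∧ A.Isometric (listSum L) := by
  induction hn : ∑ i, A.dim i using Nat.strong_induction_on generalizing A with
  | _ n ih =>
    subst hn
    by_cases h0 : A.dim = 0
    · exact ⟨[], by simp, isometric_zeroRep h0⟩
    by_cases hA : A.Indecomposable
    · exact ⟨[A], by simpa using hA, isometric_directSum_zeroRep A⟩
    simp only [Indecomposable, not_and, not_forall, not_or] at hA
    obtain ⟨B, C, hBC, hB, hC⟩ := hA h0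
    have hpos : ∀ D : QuiverRep 𝕜 V, D.dim ≠ 0 → 0 < ∑ i, D.dim i := fun D hD =>
      Finset.sum_pos' (fun _ _ => Nat.zero_le _) (by
        obtain ⟨i, hi⟩ := Function.ne_iff.1 hD
        exact ⟨i, Finset.mem_univ _, Nat.pos_of_ne_zero hi⟩)
    have hsum : ∑ i, A.dim i = ∑ i, B.dim i + ∑ i, C.dim i := by
      rw [← Finset.sum_add_distrib, hBC.dim_eq]
      rfl
    have hB' := hpos B hB
    have hC' := hpos C hC
    obtain ⟨L, hL, hBL⟩ := ih _ (by omega) B rfl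
    obtain ⟨L', hL', hCL'⟩ := ih _ (by omega) C rfl
    refine ⟨L ++ L', fun D hD => ?_,
      hBC.trans ((hBL.directSum hCL').trans (listSum_append L L').symm)⟩
    rcases List.mem_append.1 hD with h | h
    exacts [hL D h, hL' D h]

/-- Representations with the same intertwiner dimensions are isometric. -/
theorem isometric_of_homDim_eq {A B : QuiverRep 𝕜 V} (h : ∀ X, homDim X A = homDim X B) :
    A.Isometric B := by
  obtain ⟨L, hL, hAL⟩ := exists_listSum A
  obtain ⟨L', hL', hBL'⟩ := exists_listSum B
  obtain ⟨L'', hp, hf⟩ := exists_perm_forall₂ hL hL' fun X => by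
    rw [← hAL.homDim_eq, ← hBL'.homDim_eq, h]
  exact hAL.trans ((listSum_isometric_of_perm hp).trans
    ((listSum_isometric_of_forall₂ hf).trans hBL'.symm))

/-- A nonzero representation receives a nonzero intertwiner from an indecomposable one. -/
theorem exists_indecomposable_homSpace_ne_bot {A : QuiverRep 𝕜 V} (hA : A.dim ≠ 0) :
    ∃ B : QuiverRep 𝕜 V, B.Indecomposable ∧ homSpace B A ≠ ⊥ := by
  obtain ⟨L, hL, hAL⟩ := exists_listSum A
  rcases L with _ | ⟨B, L⟩
  · exact absurd hAL.dim_eq hA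
  · refine ⟨B, hL B (by simp), homDim_pos_iff.1 ?_⟩
    rw [hAL.homDim_eq, homDim_listSum, List.map_cons, List.sum_cons]
    have := (hL B (by simp)).homDim_self_pos
    omega

end Decomposition

end QuiverRep

/-! ### Real and complex matrices -/

namespace QuiverRep

section RealMatrices

variable {l m n : ℕ}

theorem conjTranspose_map_ofReal (M : Matrix (Fin m) (Fin n) ℝ) :
    (M.map (fun x : ℝ => (x : ℂ)))ᴴ = Mᴴ.map (fun x : ℝ => (x : ℂ)) := by
  ext x y; simp

theorem mul_ofReal_eq_iff {k : ℕ} (S : Matrix (Fin l) (Fin m) ℂ) (M : Matrix (Fin m) (Fin n) ℝ)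
    (N : Matrix (Fin l) (Fin k) ℝ) (T : Matrix (Fin k) (Fin n) ℂ) :
    S * M.map (fun x : ℝ => (x : ℂ)) = N.map (fun x : ℝ => (x : ℂ)) * T ↔
      S.map Complex.re * M = N * T.map Complex.re ∧
      S.map Complex.im * M = N * T.map Complex.im := by
  simp only [← Matrix.ext_iff, Complex.ext_iff, mul_apply, map_apply, Complex.re_sum,
    Complex.im_sum, Complex.re_mul_ofReal, Complex.im_mul_ofReal, Complex.re_ofReal_mul,
    Complex.im_ofReal_mul, forall_and]

theorem mul_ofReal_conjTranspose_eq_iff {k : ℕ} (S : Matrix (Fin l) (Fin m) ℂ)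
    (M : Matrix (Fin n) (Fin m) ℝ) (N : Matrix (Fin k) (Fin l) ℝ) (T : Matrix (Fin k) (Fin n) ℂ) :
    S * (M.map (fun x : ℝ => (x : ℂ)))ᴴ = (N.map (fun x : ℝ => (x : ℂ)))ᴴ * T ↔
      S.map Complex.re * Mᴴ = Nᴴ * T.map Complex.re ∧
      S.map Complex.im * Mᴴ = Nᴴ * T.map Complex.im := by
  rw [conjTranspose_map_ofReal, conjTranspose_map_ofReal, mul_ofReal_eq_iff]

theorem map_ofReal_mul (M : Matrix (Fin l) (Fin m) ℝ) (N : Matrix (Fin m) (Fin n) ℝ) :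
    (M * N).map (fun x : ℝ => (x : ℂ)) =
      M.map (fun x : ℝ => (x : ℂ)) * N.map (fun x : ℝ => (x : ℂ)) := by
  ext x y; simp [mul_apply]

theorem map_ofReal_mul_eq {k : ℕ} {S : Matrix (Fin l) (Fin m) ℝ} {M : Matrix (Fin m) (Fin n) ℝ}
    {N : Matrix (Fin l) (Fin k) ℝ} {T : Matrix (Fin k) (Fin n) ℝ} (h : S * M = N * T) :
    S.map (fun x : ℝ => (x : ℂ)) * M.map (fun x : ℝ => (x : ℂ)) =
      N.map (fun x : ℝ => (x : ℂ)) * T.map (fun x : ℝ => (x : ℂ)) := by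
  rw [← map_ofReal_mul, ← map_ofReal_mul, h]

theorem map_ofReal_conjTranspose_mul_eq {k : ℕ} {S : Matrix (Fin l) (Fin m) ℝ}
    {M : Matrix (Fin n) (Fin m) ℝ} {N : Matrix (Fin k) (Fin l) ℝ} {T : Matrix (Fin k) (Fin n) ℝ}
    (h : S * Mᴴ = Nᴴ * T) :
    S.map (fun x : ℝ => (x : ℂ)) * (M.map (fun x : ℝ => (x : ℂ)))ᴴ =
      (N.map (fun x : ℝ => (x : ℂ)))ᴴ * T.map (fun x : ℝ => (x : ℂ)) := by
  rw [conjTranspose_map_ofReal, conjTranspose_map_ofReal, map_ofReal_mul_eq h]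

theorem map_ofReal_unitary {M : Matrix (Fin m) (Fin n) ℝ} (h : Mᴴ * M = 1 ∧ M * Mᴴ = 1) :
    (M.map (fun x : ℝ => (x : ℂ)))ᴴ * M.map (fun x : ℝ => (x : ℂ)) = 1 ∧
      M.map (fun x : ℝ => (x : ℂ)) * (M.map (fun x : ℝ => (x : ℂ)))ᴴ = 1 := by
  rw [conjTranspose_map_ofReal, ← map_ofReal_mul, ← map_ofReal_mul, h.1, h.2]
  constructor <;> ext x y <;> simp [one_apply, apply_ite]

theorem map_ofReal_isHermitian {M : Matrix (Fin m) (Fin m) ℝ} (h : M.IsHermitian) :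
    (M.map (fun x : ℝ => (x : ℂ))).IsHermitian := by
  unfold IsHermitian
  rw [conjTranspose_map_ofReal, h.eq]

theorem eq_re_smul_one_of_map_ofReal {M : Matrix (Fin m) (Fin m) ℝ} {c : ℂ}
    (h : M.map (fun x : ℝ => (x : ℂ)) = c • 1) : M = c.re • 1 := by
  ext x y
  have := congrArg Complex.re (congrFun (congrFun h x) y)
  by_cases hxy : x = y <;> simpa [one_apply, hxy] using this

/-- A complex `m × n` matrix as a real `m × 2n` matrix: an entry becomes the pair of its real and
imaginary part. -/
def realifyRows (T : Matrix (Fin m) (Fin n) ℂ) : Matrix (Fin m) (Fin (n * 2)) ℝ :=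
  Matrix.reindex (Equiv.refl _) finProdFinEquiv
    (Matrix.of fun (r : Fin m) (c : Fin n × Fin 2) => ![(T r c.1).re, (T r c.1).im] c.2)

theorem realifyRows_surjective (R : Matrix (Fin m) (Fin (n * 2)) ℝ) :
    ∃ T : Matrix (Fin m) (Fin n) ℂ, realifyRows T = R := by
  refine ⟨fun x y => ⟨R x (finProdFinEquiv (y, 0)), R x (finProdFinEquiv (y, 1))⟩, ?_⟩
  ext x y
  obtain ⟨⟨y, k⟩, rfl⟩ := finProdFinEquiv.surjective y
  fin_cases k <;> simp [realifyRows]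

theorem realifyRows_injective :
    Function.Injective (realifyRows : Matrix (Fin m) (Fin n) ℂ → _) := by
  intro S T h
  ext x y
  have h0 := congrFun (congrFun h x) (finProdFinEquiv (y, 0))
  have h1 := congrFun (congrFun h x) (finProdFinEquiv (y, 1))
  simp only [realifyRows, reindex_apply, submatrix_apply, Equiv.symm_apply_apply, of_apply,
    Equiv.refl_symm, Equiv.refl_apply, cons_val_zero, cons_val_one] at h0 h1
  exact Complex.ext h0 h1

theorem realifyRows_zero : realifyRows (0 : Matrix (Fin m) (Fin n) ℂ) = 0 := by
  ext x y
  obtain ⟨⟨y, k⟩, rfl⟩ := finProdFinEquiv.surjective y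
  fin_cases k <;> simp [realifyRows]

theorem realifyRows_mul (S : Matrix (Fin l) (Fin m) ℂ) (M : Matrix (Fin m) (Fin n) ℂ) :
    realifyRows (S * M) = realifyRows S * realifyMatrix M := by
  ext x y
  obtain ⟨⟨y, k⟩, rfl⟩ := finProdFinEquiv.surjective y
  rw [mul_apply, ← finProdFinEquiv.sum_comp, Fintype.sum_prod_type]
  fin_cases k <;>
    simp [realifyRows, realifyMatrix, mul_apply, Fin.sum_univ_two,
      sub_eq_add_neg]

theorem realifyRows_ofReal_mul (M : Matrix (Fin l) (Fin m) ℝ) (S : Matrix (Fin m) (Fin n) ℂ) :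
    realifyRows (M.map (fun x : ℝ => (x : ℂ)) * S) = M * realifyRows S := by
  ext x y
  obtain ⟨⟨y, k⟩, rfl⟩ := finProdFinEquiv.surjective y
  fin_cases k <;> simp [realifyRows, mul_apply]

theorem realifyMatrix_conjTranspose (M : Matrix (Fin m) (Fin n) ℂ) :
    (realifyMatrix M)ᴴ = realifyMatrix Mᴴ := by
  ext x y
  obtain ⟨⟨x, j⟩, rfl⟩ := finProdFinEquiv.surjective x
  obtain ⟨⟨y, k⟩, rfl⟩ := finProdFinEquiv.surjective y
  fin_cases j <;> fin_cases k <;> simp [realifyMatrix]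

/-- The matrix with rows `(1, -i)` in each block, projecting the complexification of a
realification onto the original. -/
def unrealify (n : ℕ) : Matrix (Fin n) (Fin (n * 2)) ℂ :=
  Matrix.reindex (Equiv.refl _) finProdFinEquiv
    (Matrix.of fun (r : Fin n) (c : Fin n × Fin 2) => if r = c.1 then ![1, -Complex.I] c.2 else 0)

theorem unrealify_mul (M : Matrix (Fin m) (Fin n) ℂ) :
    unrealify m * (realifyMatrix M).map (fun x : ℝ => (x : ℂ)) = M * unrealify n := by
  ext x y
  obtain ⟨⟨y, k⟩, rfl⟩ := finProdFinEquiv.surjective y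
  rw [mul_apply, ← finProdFinEquiv.sum_comp, Fintype.sum_prod_type]
  fin_cases k <;>
    simp [unrealify, realifyMatrix, mul_apply, Fin.sum_univ_two] <;>
    apply Complex.ext <;> simp

/-- The projections `unrealify` and its conjugate together determine a vector. -/
theorem unrealify_adjoint_mul_add : (unrealify n)ᴴ * unrealify n +
    ((unrealify n).map (starRingEnd ℂ))ᴴ * (unrealify n).map (starRingEnd ℂ) =
      (2 : ℂ) • 1 := by
  ext x y
  obtain ⟨⟨x, j⟩, rfl⟩ := finProdFinEquiv.surjective x
  obtain ⟨⟨y, k⟩, rfl⟩ := finProdFinEquiv.surjective y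
  simp only [Matrix.add_apply, mul_apply, conjTranspose_apply, map_apply, unrealify, reindex_apply,
    submatrix_apply, Equiv.symm_apply_apply, Equiv.refl_symm, Equiv.refl_apply, of_apply,
    Matrix.smul_apply, one_apply, finProdFinEquiv.injective.eq_iff, Prod.mk.injEq, smul_eq_mul]
  by_cases hxy : x = y
  · subst hxy
    fin_cases j <;> fin_cases k <;> simp [apply_ite] <;> norm_num
  · have h : ∀ z, ¬ (z = x ∧ z = y) := fun z hz => hxy (hz.1.symm.trans hz.2)
    simp only [hxy, false_and, if_false, mul_zero, ← Finset.sum_add_distrib]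
    refine Finset.sum_eq_zero fun z _ => ?_
    by_cases hz : z = x
    · simp [hz, hxy]
    · simp [hz]

theorem map_conj_mul (M : Matrix (Fin l) (Fin m) ℂ) (N : Matrix (Fin m) (Fin n) ℂ) :
    (M * N).map (starRingEnd ℂ) = M.map (starRingEnd ℂ) * N.map (starRingEnd ℂ) := by
  ext x y; simp [mul_apply]

theorem map_conj_conjTranspose (M : Matrix (Fin l) (Fin m) ℂ) :
    (M.map (starRingEnd ℂ))ᴴ = Mᴴ.map (starRingEnd ℂ) := by
  ext x y; simp

theorem map_conj_conjTranspose_mul_eq {k : ℕ} {S : Matrix (Fin l) (Fin m) ℂ}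
    {M : Matrix (Fin n) (Fin m) ℂ} {N : Matrix (Fin k) (Fin l) ℂ} {T : Matrix (Fin k) (Fin n) ℂ}
    (h : S * Mᴴ = Nᴴ * T) : S.map (starRingEnd ℂ) * (M.map (starRingEnd ℂ))ᴴ =
      (N.map (starRingEnd ℂ))ᴴ * T.map (starRingEnd ℂ) := by
  rw [map_conj_conjTranspose, map_conj_conjTranspose, ← map_conj_mul, ← map_conj_mul, h]

theorem map_conj_map_conj (M : Matrix (Fin l) (Fin m) ℂ) :
    (M.map (starRingEnd ℂ)).map (starRingEnd ℂ) = M := by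
  ext x y; simp

theorem map_conj_mul_eq_of_map_conj {k : ℕ} {S : Matrix (Fin l) (Fin m) ℂ}
    {M : Matrix (Fin m) (Fin n) ℂ} {N : Matrix (Fin l) (Fin k) ℂ} {T : Matrix (Fin k) (Fin n) ℂ}
    (h : S * M.map (starRingEnd ℂ) = N.map (starRingEnd ℂ) * T) :
    S.map (starRingEnd ℂ) * M = N * T.map (starRingEnd ℂ) := by
  have h1 := congrArg (fun M => M.map (starRingEnd ℂ)) h
  simp only [map_conj_mul, map_conj_map_conj] at h1
  exact h1

theorem eq_zero_of_map_conj {M : Matrix (Fin l) (Fin m) ℂ} (h : M.map (starRingEnd ℂ) = 0) :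
    M = 0 := by
  rw [← map_conj_map_conj M, h]
  ext x y; simp

theorem map_conj_one : (1 : Matrix (Fin m) (Fin m) ℂ).map (starRingEnd ℂ) = 1 := by
  ext x y; simp [one_apply, apply_ite]

theorem map_conj_unitary {M : Matrix (Fin m) (Fin n) ℂ} (h : Mᴴ * M = 1 ∧ M * Mᴴ = 1) :
    (M.map (starRingEnd ℂ))ᴴ * M.map (starRingEnd ℂ) = 1 ∧
      M.map (starRingEnd ℂ) * (M.map (starRingEnd ℂ))ᴴ = 1 := by
  rw [map_conj_conjTranspose, ← map_conj_mul, ← map_conj_mul, h.1, h.2]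
  exact ⟨map_conj_one, map_conj_one⟩

theorem map_conj_isHermitian {M : Matrix (Fin m) (Fin m) ℂ} (h : M.IsHermitian) :
    (M.map (starRingEnd ℂ)).IsHermitian := by
  unfold IsHermitian
  rw [map_conj_conjTranspose, h.eq]

theorem eq_conj_smul_one_of_map_conj {M : Matrix (Fin m) (Fin m) ℂ} {c : ℂ}
    (h : M.map (starRingEnd ℂ) = c • 1) : M = (starRingEnd ℂ c) • 1 := by
  rw [← map_conj_map_conj M, h]
  ext x y
  by_cases hxy : x = y <;> simp [one_apply, hxy]

end RealMatrices

/-! ### Complexification -/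

section Complexification

variable {V : Type u} [Quiver.{v} V] {A B : QuiverRep ℝ V}

theorem mem_homSpace_complexify
    {S : ∀ i, Matrix (Fin (B.complexify.dim i)) (Fin (A.complexify.dim i)) ℂ} :
    S ∈ homSpace A.complexify B.complexify ↔
      (fun i => (S i).map Complex.re) ∈ homSpace A B ∧
      (fun i => (S i).map Complex.im) ∈ homSpace A B := by
  refine ⟨fun h => ⟨fun i j α => ?_, fun i j α => ?_⟩, fun h i j α => ?_⟩
  · exact ⟨((mul_ofReal_eq_iff _ _ _ _).1 (h i j α).1).1,
      ((mul_ofReal_conjTranspose_eq_iff _ _ _ _).1 (h i j α).2).1⟩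
  · exact ⟨((mul_ofReal_eq_iff _ _ _ _).1 (h i j α).1).2,
      ((mul_ofReal_conjTranspose_eq_iff _ _ _ _).1 (h i j α).2).2⟩
  · exact ⟨(mul_ofReal_eq_iff _ _ _ _).2 ⟨(h.1 i j α).1, (h.2 i j α).1⟩,
      (mul_ofReal_conjTranspose_eq_iff _ _ _ _).2 ⟨(h.1 i j α).2, (h.2 i j α).2⟩⟩

theorem map_ofReal_mem_homSpace {S : ∀ i, Matrix (Fin (B.dim i)) (Fin (A.dim i)) ℝ}
    (hS : S ∈ homSpace A B) :
    (fun i => (S i).map (fun x : ℝ => (x : ℂ))) ∈ homSpace A.complexify B.complexify :=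
  fun i j α => ⟨map_ofReal_mul_eq (hS i j α).1, map_ofReal_conjTranspose_mul_eq (hS i j α).2⟩

/-- Intertwiners of complexifications are pairs of real intertwiners, their real and imaginary
parts. -/
theorem homDim_complexify [Finite V] : homDim A.complexify B.complexify = homDim A B := by
  have e : homSpace A.complexify B.complexify ≃ₗ[ℝ] homSpace A B × homSpace A B :=
    { toFun := fun S => (⟨_, (mem_homSpace_complexify.1 S.2).1⟩,
        ⟨_, (mem_homSpace_complexify.1 S.2).2⟩)
      invFun := fun R => ⟨_, (homSpace A.complexify B.complexify).add_mem
        (map_ofReal_mem_homSpace R.1.2)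
        ((homSpace A.complexify B.complexify).smul_mem Complex.I (map_ofReal_mem_homSpace R.2.2))⟩
      map_add' := fun P Q => by
        refine Prod.ext (Subtype.ext ?_) (Subtype.ext ?_) <;> funext i <;> ext x y <;> rfl
      map_smul' := fun c P => by
        refine Prod.ext (Subtype.ext ?_) (Subtype.ext ?_) <;> funext i <;> ext x y
        · exact Complex.smul_re c _
        · exact Complex.smul_im c _
      left_inv := fun S => by
        refine Subtype.ext (funext fun i => ?_)
        ext x y
        apply Complex.ext
        · change (((S.1 i x y).re : ℂ) + Complex.I * ((S.1 i x y).im : ℂ)).re = _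
          simp
        · change (((S.1 i x y).re : ℂ) + Complex.I * ((S.1 i x y).im : ℂ)).im = _
          simp
      right_inv := fun R => by
        refine Prod.ext (Subtype.ext ?_) (Subtype.ext ?_) <;> funext i <;> ext x y
        · change (((R.1.1 i x y : ℝ) : ℂ) + Complex.I * ((R.2.1 i x y : ℝ) : ℂ)).re = _
          simp
        · change (((R.1.1 i x y : ℝ) : ℂ) + Complex.I * ((R.2.1 i x y : ℝ) : ℂ)).im = _
          simp }
  have h1 := e.finrank_eq
  rw [Module.finrank_prod] at h1
  have h2 := finrank_real_of_complex (homSpace A.complexify B.complexify)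
  have h3 : 2 * homDim A.complexify B.complexify = homDim A B + homDim A B := h2.symm.trans h1
  omega

theorem Isometric.complexify (h : A.Isometric B) : A.complexify.Isometric B.complexify := by
  obtain ⟨S, hS, hU⟩ := isometric_iff.1 h
  exact isometric_iff.2 ⟨_, map_ofReal_mem_homSpace hS, fun i => map_ofReal_unitary (hU i)⟩

/-- Euclidean representations that are isometric over `ℂ` are isometric over `ℝ`, since isometry
classes are determined by dimensions of intertwiner spaces. -/
theorem isometric_iff_complexify [Fintype V] :
    A.Isometric B ↔ A.complexify.Isometric B.complexify :=
  ⟨Isometric.complexify, fun h => isometric_of_homDim_eq fun X => by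
    rw [← homDim_complexify, ← homDim_complexify, h.homDim_eq]⟩

theorem indecomposable_of_complexify (h : A.complexify.Indecomposable) : A.Indecomposable := by
  refine indecomposable_iff.2 ⟨h.1, fun H hH hc => ?_⟩
  obtain ⟨c, hc⟩ := h.isSchurian (fun i => (H i).map (fun x : ℝ => (x : ℂ)))
    (fun i => map_ofReal_isHermitian (hH i))
    fun i j α => (map_ofReal_mem_homSpace (mem_homSpace_of_isHermitian hH hc) i j α).1
  exact ⟨c.re, fun i => eq_re_smul_one_of_map_ofReal (hc i)⟩

theorem complexify_injective : Function.Injective (complexify (V := V)) := by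
  rintro ⟨d, M⟩ ⟨d', M'⟩ h
  obtain rfl : d = d' := congrArg QuiverRep.dim h
  rw [QuiverRep.mk.injEq]
  refine ⟨rfl, heq_of_eq ?_⟩
  simp only [complexify, QuiverRep.mk.injEq, true_and, heq_eq_eq] at h
  funext i j α
  ext x y
  have := congrFun (congrFun (congrFun (congrFun (congrFun h i) j) α) x) y
  exact Complex.ofReal_injective this

end Complexification

/-! ### Complex conjugation -/

section Conjugation

variable {V : Type u} [Quiver.{v} V] {A B : QuiverRep ℂ V}

theorem map_conj_mem_homSpace {S : ∀ i, Matrix (Fin (B.dim i)) (Fin (A.dim i)) ℂ}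
    (hS : S ∈ homSpace A B) : (fun i => (S i).map (starRingEnd ℂ)) ∈ homSpace A.conj B.conj := by
  intro i j α
  constructor
  · exact (map_conj_mul _ _).symm.trans
      ((congrArg (fun M => M.map (starRingEnd ℂ)) (hS i j α).1).trans (map_conj_mul _ _))
  · exact map_conj_conjTranspose_mul_eq (hS i j α).2

theorem conj_complexify (A : QuiverRep ℝ V) : A.complexify.conj = A.complexify := by
  simp [conj, complexify, Matrix.map_map, Function.comp_def]

theorem Isometric.conj (h : A.Isometric B) : A.conj.Isometric B.conj := by
  obtain ⟨S, hS, hU⟩ := isometric_iff.1 h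
  exact isometric_iff.2 ⟨_, map_conj_mem_homSpace hS, fun i => map_conj_unitary (hU i)⟩

theorem Indecomposable.conj (h : A.Indecomposable) : A.conj.Indecomposable := by
  refine indecomposable_iff.2 ⟨h.1, fun H hH hc => ?_⟩
  obtain ⟨c, hc⟩ := h.isSchurian (fun i => (H i).map (starRingEnd ℂ))
    (fun i => map_conj_isHermitian (hH i)) fun i j α =>
      map_conj_mul_eq_of_map_conj (hc i j α)
  exact ⟨starRingEnd ℂ c, fun i => eq_conj_smul_one_of_map_conj (hc i)⟩

theorem homSpace_conj_ne_bot (h : homSpace A B ≠ ⊥) : homSpace A.conj B.conj ≠ ⊥ := by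
  obtain ⟨S, hS, hS0⟩ := Submodule.exists_mem_ne_zero_of_ne_bot h
  refine (Submodule.ne_bot_iff _).2 ⟨_, map_conj_mem_homSpace hS, fun h0 => hS0
    (funext fun i => eq_zero_of_map_conj (congrFun h0 i))⟩

theorem homSpace_ne_bot_of_isometric {𝕜 : Type} [RCLike 𝕜] {A A' B : QuiverRep 𝕜 V}
    (h : A.Isometric A') (hAB : homSpace A B ≠ ⊥) : homSpace A' B ≠ ⊥ := by
  obtain ⟨S, hS, hS0⟩ := Submodule.exists_mem_ne_zero_of_ne_bot hAB
  obtain ⟨U, hU, hUU⟩ := isometric_iff.1 h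
  refine (Submodule.ne_bot_iff _).2
    ⟨_, comp_mem_homSpace hS (adjoint_mem_homSpace hU), fun h0 => hS0 ?_⟩
  funext i
  have h1 := congrArg (fun M => M * U i) (congrFun h0 i)
  simp only [Matrix.mul_assoc, (hUU i).1, Matrix.mul_one, Pi.zero_apply, Matrix.zero_mul] at h1
  exact h1

end Conjugation

end QuiverRep

/-! ### Realification and the classification of Euclidean representations -/

namespace QuiverRep

section Realification

variable {V : Type u} [Quiver.{v} V]

/-- Intertwiners from a unitary representation to a Euclidean one are real intertwiners from its
realification. -/
theorem realifyRows_mem_homSpace {X : QuiverRep ℂ V} {A : QuiverRep ℝ V}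
    {T : ∀ i, Matrix (Fin (A.dim i)) (Fin (X.dim i)) ℂ} :
    (fun i => realifyRows (T i)) ∈ homSpace X.realify A ↔ T ∈ homSpace X A.complexify := by
  have key : ∀ {l m n k : ℕ} (T : Matrix (Fin l) (Fin m) ℂ) (M : Matrix (Fin m) (Fin n) ℂ)
      (N : Matrix (Fin l) (Fin k) ℝ) (S : Matrix (Fin k) (Fin n) ℂ),
      realifyRows T * realifyMatrix M = N * realifyRows S ↔
        T * M = N.map (fun x : ℝ => (x : ℂ)) * S := by
    intro l m n k T M N S
    rw [← realifyRows_mul, ← realifyRows_ofReal_mul, realifyRows_injective.eq_iff]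
  have key' : ∀ {l m n k : ℕ} (T : Matrix (Fin l) (Fin m) ℂ) (M : Matrix (Fin n) (Fin m) ℂ)
      (N : Matrix (Fin k) (Fin l) ℝ) (S : Matrix (Fin k) (Fin n) ℂ),
      realifyRows T * (realifyMatrix M)ᴴ = Nᴴ * realifyRows S ↔
        T * Mᴴ = (N.map (fun x : ℝ => (x : ℂ)))ᴴ * S := by
    intro l m n k T M N S
    rw [realifyMatrix_conjTranspose, key, conjTranspose_map_ofReal]
  exact ⟨fun h i j α => ⟨(key _ _ _ _).1 (h i j α).1, (key' _ _ _ _).1 (h i j α).2⟩,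
    fun h i j α => ⟨(key _ _ _ _).2 (h i j α).1, (key' _ _ _ _).2 (h i j α).2⟩⟩

theorem homSpace_realify_ne_bot_iff {X : QuiverRep ℂ V} {A : QuiverRep ℝ V} :
    homSpace X.realify A ≠ ⊥ ↔ homSpace X A.complexify ≠ ⊥ := by
  constructor <;> intro h
  · obtain ⟨R, hR, hR0⟩ := Submodule.exists_mem_ne_zero_of_ne_bot h
    choose T hT using fun i => realifyRows_surjective (R i)
    obtain rfl : (fun i => realifyRows (T i)) = R := funext hT
    refine (Submodule.ne_bot_iff _).2 ⟨T, realifyRows_mem_homSpace.1 hR, fun h0 => hR0 ?_⟩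
    funext i
    change realifyRows (T i) = 0
    rw [h0]
    exact realifyRows_zero
  · obtain ⟨T, hT, hT0⟩ := Submodule.exists_mem_ne_zero_of_ne_bot h
    refine (Submodule.ne_bot_iff _).2 ⟨_, realifyRows_mem_homSpace.2 hT, fun h0 => hT0 ?_⟩
    funext i
    exact realifyRows_injective ((congrFun h0 i).trans realifyRows_zero.symm)

theorem unrealify_mem_homSpace (Y : QuiverRep ℂ V) :
    (fun i => unrealify (Y.dim i)) ∈ homSpace Y.realify.complexify Y := by
  intro i j α
  refine ⟨unrealify_mul (Y.mat α), ?_⟩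
  have h := unrealify_mul (Y.mat α)ᴴ
  rw [← realifyMatrix_conjTranspose, ← conjTranspose_map_ofReal] at h
  exact h

theorem unrealify_conj_mem_homSpace (Y : QuiverRep ℂ V) :
    (fun i => (unrealify (Y.dim i)).map (starRingEnd ℂ)) ∈
      homSpace Y.realify.complexify Y.conj := by
  have key : ∀ {k l m n : ℕ} {S : Matrix (Fin l) (Fin m) ℂ} {M : Matrix (Fin m) (Fin n) ℝ}
      {N : Matrix (Fin l) (Fin k) ℂ} {T : Matrix (Fin k) (Fin n) ℂ},
      S * M.map (fun x : ℝ => (x : ℂ)) = N * T →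
      S.map (starRingEnd ℂ) * M.map (fun x : ℝ => (x : ℂ)) =
        N.map (starRingEnd ℂ) * T.map (starRingEnd ℂ) := by
    intro k l m n S M N T h
    rw [← map_conj_mul, ← h, map_conj_mul, Matrix.map_map]
    congr 1
    ext x y; simp
  intro i j α
  refine ⟨key (unrealify_mul (Y.mat α)), ?_⟩
  have h := key (unrealify_mul (Y.mat α)ᴴ)
  rw [← realifyMatrix_conjTranspose, ← conjTranspose_map_ofReal, ← map_conj_conjTranspose] at h
  exact h

/-- The complexification of the realification of `Y` is the sum of `Y` and its conjugate; only the
resulting alternative for intertwiners is needed. -/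
theorem homSpace_ne_bot_or_of_realify {A Y : QuiverRep ℂ V}
    (h : homSpace A Y.realify.complexify ≠ ⊥) : homSpace A Y ≠ ⊥ ∨ homSpace A Y.conj ≠ ⊥ := by
  obtain ⟨T, hT, hT0⟩ := Submodule.exists_mem_ne_zero_of_ne_bot h
  by_contra! h0
  have h1 := comp_mem_homSpace (unrealify_mem_homSpace Y) hT
  have h2 := comp_mem_homSpace (unrealify_conj_mem_homSpace Y) hT
  rw [h0.1, Submodule.mem_bot] at h1
  rw [h0.2, Submodule.mem_bot] at h2
  have key : ∀ {n k : ℕ} (T : Matrix (Fin (n * 2)) (Fin k) ℂ), unrealify n * T = 0 →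
      (unrealify n).map (starRingEnd ℂ) * T = 0 → T = 0 := by
    intro n k T h1 h2
    have h3 := congrArg (fun M => M * T) (unrealify_adjoint_mul_add (n := n))
    simp only [Matrix.add_mul, Matrix.mul_assoc, h1, h2, Matrix.mul_zero, add_zero,
      Matrix.smul_mul, Matrix.one_mul] at h3
    exact (smul_eq_zero.1 h3.symm).resolve_left two_ne_zero
  exact hT0 (funext fun i => key (T i) (congrFun h1 i) (congrFun h2 i))

theorem IsometricToEuclidean.isometric_conj {X : QuiverRep ℂ V} (h : X.IsometricToEuclidean) :
    X.Isometric X.conj := by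
  obtain ⟨E, hE⟩ := h
  have h1 := hE.conj
  rw [conj_complexify] at h1
  exact hE.trans h1.symm

/-- The realification of an indecomposable representation that is not Euclidean up to isometry is
indecomposable: both parts of a decomposition would contain it after complexification, and then
have its dimension, hence be isometric to it. -/
theorem Indecomposable.realify {X : QuiverRep ℂ V} (hX : X.Indecomposable)
    (hE : ¬ X.IsometricToEuclidean) : X.realify.Indecomposable := by
  refine ⟨fun h => hX.1 (funext fun i => ?_), fun B C hBC => ?_⟩
  · have h1 : X.dim i * 2 = 0 := congrFun h i
    change X.dim i = 0
    omega
  by_contra! hne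
  obtain ⟨S, T, hST⟩ := exists_isOrthogonalSum hBC
  have aux : ∀ {D : QuiverRep ℝ V} {S : ∀ i, Matrix (Fin (X.realify.dim i)) (Fin (D.dim i)) ℝ},
      S ∈ homSpace D X.realify → (∀ i, (S i)ᴴ * S i = 1) → D.dim ≠ 0 →
      ∃ R ∈ homSpace X D.complexify, ∀ i, (R i)ᴴ * R i = 1 := by
    intro D S hS hS1 hD
    refine hX.exists_isometry (homSpace_realify_ne_bot_iff.1 fun h0 => ?_)
    have h1 := adjoint_mem_homSpace hS
    rw [h0, Submodule.mem_bot] at h1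
    obtain ⟨i, hi⟩ := Function.ne_iff.1 hD
    have h2 := hS1 i
    have h3 : (S i)ᴴ = 0 := congrFun h1 i
    rw [h3, Matrix.zero_mul] at h2
    exact one_ne_zero (eq_zero_of_smul_one_eq_zero (𝕜 := ℝ) hi (by rw [one_smul, h2]))
  have le : ∀ {m n : ℕ} {R : Matrix (Fin m) (Fin n) ℂ}, Rᴴ * R = 1 → n ≤ m := by
    intro m n R h
    have h1 := rank_mul_le_right Rᴴ R
    rw [h, rank_one, Fintype.card_fin] at h1
    exact h1.trans ((rank_le_card_height R).trans (Fintype.card_fin m).le)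
  obtain ⟨R, hR, hRU⟩ := aux hST.left_mem hST.left_left hne.1
  obtain ⟨R', -, hRU'⟩ := aux hST.right_mem hST.right_right hne.2
  have hdim : ∀ i, X.dim i = B.dim i := by
    intro i
    have h1 : X.dim i * 2 = B.dim i + C.dim i := congrFun hBC.dim_eq i
    have h2 : X.dim i ≤ B.dim i := le (hRU i)
    have h3 : X.dim i ≤ C.dim i := le (hRU' i)
    omega
  refine hE ⟨B, isometric_iff.2 ⟨R, hR, fun i => ⟨hRU i, ?_⟩⟩⟩
  exact (mul_eq_one_comm_of_equiv (finCongr (hdim i)) (A := (R i)ᴴ) (B := R i)).1 (hRU i)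

theorem IsIndOne.not_isometricToEuclidean {I K : Set (QuiverRep ℂ V)} (hK : IsIndOne I K)
    {X : QuiverRep ℂ V} (hX : X ∈ K) : ¬ X.IsometricToEuclidean := fun h =>
  (hK.2.1 X (hK.1 hX) h.isometric_conj).1 hX h

variable [Fintype V]

theorem Indecomposable.homSpace_ne_bot {𝕜 : Type} [RCLike 𝕜] {A B : QuiverRep 𝕜 V}
    (hA : A.Indecomposable) (h : A.Isometric B) : homSpace A B ≠ ⊥ := by
  rw [← homDim_pos_iff, ← h.homDim_eq]
  exact hA.homDim_self_pos

/-- The Euclidean members of `I` and the realifications of the members of `K` form a complete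
system. An indecomposable Euclidean `A` receives, over `ℂ`, a nonzero intertwiner from some `X ∈ I`;
it is isometric to `X` if `X` is Euclidean, and to the realification of `X` or of its conjugate
otherwise. -/
theorem isCompleteSystem_indZero_union {I K : Set (QuiverRep ℂ V)}
    (hI : IsNormalizedCompleteSystem I) (hK : IsIndOne I K) :
    IsCompleteSystem (indZero I ∪ realify '' K) := by
  have hKind : ∀ X ∈ K, X.Indecomposable := fun X hX => hI.1.1 X (hK.1 hX)
  have mixed : ∀ E ∈ indZero I, ∀ X ∈ K, ¬ E.Isometric X.realify := by
    intro E hE X hX h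
    have h1 : homSpace X.realify E ≠ ⊥ := Indecomposable.homSpace_ne_bot
      ((hKind X hX).realify (hK.not_isometricToEuclidean hX)) h.symm
    exact hK.not_isometricToEuclidean hX ⟨E, (hKind X hX).isometric (hI.1.1 _ hE)
      (homSpace_realify_ne_bot_iff.1 h1)⟩
  refine ⟨?_, ?_, fun A hA => ?_⟩
  · rintro A (hA | ⟨X, hX, rfl⟩)
    · exact indecomposable_of_complexify (hI.1.1 _ hA)
    · exact (hKind X hX).realify (hK.not_isometricToEuclidean hX)
  · rintro A (hA | ⟨X, hX, rfl⟩) B (hB | ⟨Y, hY, rfl⟩) hAB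
    · exact complexify_injective (hI.1.2.1 _ hA _ hB hAB.complexify)
    · exact (mixed A hA Y hY hAB).elim
    · exact (mixed B hB X hX hAB.symm).elim
    · have hXi := hKind X hX
      have hYi := hKind Y hY
      have h1 := homSpace_realify_ne_bot_iff.1 (Indecomposable.homSpace_ne_bot
        (hXi.realify (hK.not_isometricToEuclidean hX)) hAB)
      rcases homSpace_ne_bot_or_of_realify h1 with h | h
      · rw [hI.1.2.1 X (hK.1 hX) Y (hK.1 hY) (hXi.isometric hYi h)]
      · have h2 := hXi.isometric hYi.conj h
        by_cases h3 : Y.Isometric Y.conj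
        · rw [hI.1.2.1 X (hK.1 hX) Y (hK.1 hY) (h2.trans h3.symm)]
        · rcases hK.2.2 Y (hK.1 hY) X (hK.1 hX) h3 h2.symm with h4 | h4
          · exact (h4.2 hX).elim
          · exact (h4.2 hY).elim
  · obtain ⟨Z, hZ, hZA⟩ := exists_indecomposable_homSpace_ne_bot (A := A.complexify) hA.1
    obtain ⟨X, hX, hZX⟩ := hI.1.2.2 Z hZ
    have hXA := homSpace_ne_bot_of_isometric hZX hZA
    by_cases hE : X.IsometricToEuclidean
    · obtain ⟨E, rfl⟩ := hI.2 X hX hE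
      refine ⟨E, Or.inl hX, ?_⟩
      refine ((indecomposable_of_complexify (hI.1.1 _ hX)).isometric hA ?_).symm
      rwa [← homDim_pos_iff, ← homDim_complexify, homDim_pos_iff]
    · suffices h : ∃ Y ∈ K, homSpace Y A.complexify ≠ ⊥ by
        obtain ⟨Y, hY, hYA⟩ := h
        exact ⟨_, Or.inr ⟨Y, hY, rfl⟩, (((hKind Y hY).realify
          (hK.not_isometricToEuclidean hY)).isometric hA
            (homSpace_realify_ne_bot_iff.2 hYA)).symm⟩
      by_cases hc : X.Isometric X.conj
      · exact ⟨X, (hK.2.1 X hX hc).2 hE, hXA⟩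
      · obtain ⟨Y, hY, hXY⟩ := hI.1.2.2 X.conj (hI.1.1 X hX).conj
        rcases hK.2.2 X hX Y hY hc hXY with h | h
        · exact ⟨X, h.1, hXA⟩
        · -- Here `Y` represents the conjugate of `X`, which maps to the real representation too.
          refine ⟨Y, h.1, homSpace_ne_bot_of_isometric hXY ?_⟩
          have h1 := homSpace_conj_ne_bot hXA
          rwa [conj_complexify] at h1

end Realification

end QuiverRep

/-! ### Dimensions of indecomposable representations: necessary conditions -/

namespace QuiverDim

variable {V : Type u} [Quiver.{v} V]

/-- The coordinates of all spaces reached from the vertex `i` along an arrow in either direction,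
one copy for each arrow. -/
abbrev StarIndex (X : V → Type) (i : V) : Type (max u v) :=
  (Σ l, (i ⟶ l) × X l) ⊕ (Σ k, (k ⟶ i) × X k)

theorem adj_of_arrow {i j : V} (hij : i ≠ j) (α : i ⟶ j) : (underlyingGraph V).Adj i j := by
  rw [underlyingGraph, SimpleGraph.fromRel_adj]
  exact ⟨hij, Or.inl ⟨α⟩⟩

variable [DecidableEq V] [∀ i j : V, Fintype (i ⟶ j)]

theorem isEmpty_loop {i : V} (hi : arrowMatrix V i i = 0) : IsEmpty (i ⟶ i) := by
  rw [← Fintype.card_eq_zero_iff]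
  simpa [arrowMatrix] using hi

variable [Fintype V]

/-- The neighbourhood of a vertex without loops has dimension `(z M) i`. -/
theorem card_starIndex (X : V → Type) [∀ k, Fintype (X k)] {i : V}
    (hi : arrowMatrix V i i = 0) :
    Fintype.card (StarIndex X i) = ((fun k => Fintype.card (X k)) ᵥ* arrowMatrix V) i := by
  rw [Fintype.card_sum, Fintype.card_sigma, Fintype.card_sigma, ← Finset.sum_add_distrib, vecMul,
    dotProduct]
  refine Finset.sum_congr rfl fun k _ => ?_
  rw [Fintype.card_prod, Fintype.card_prod]
  by_cases hk : k = i
  · subst hk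
    have h : Fintype.card (k ⟶ k) = 0 := by simpa [arrowMatrix] using hi
    rw [hi, h]; simp
  · rw [arrowMatrix, if_neg hk]; ring

theorem le_vecMul_of_loop {i : V} (hi : arrowMatrix V i i ≠ 0) (z : V → ℕ) :
    z i ≤ (z ᵥ* arrowMatrix V) i :=
  (Nat.le_mul_of_pos_right _ (Nat.pos_of_ne_zero hi)).trans
    (Finset.single_le_sum (f := fun k => z k * arrowMatrix V k i) (fun _ _ => Nat.zero_le _)
      (Finset.mem_univ i))

end QuiverDim

namespace QuiverRep

open QuiverDim

section Necessity

variable {V : Type u} [Quiver.{v} V] {𝕜 : Type} [RCLike 𝕜] {A : QuiverRep 𝕜 V}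

theorem matrix_eq_of_dim_eq_zero {R : Type} {m n : ℕ} (h : m = 0 ∨ n = 0)
    (M N : Matrix (Fin m) (Fin n) R) :
    M = N := by
  ext x y
  rcases h with rfl | rfl
  exacts [x.elim0, y.elim0]

/-- The support is connected, because the projection onto one of its connected components is an
endomorphism. -/
theorem Indecomposable.suppConnected (hA : A.Indecomposable) : SuppConnected A.dim := by
  classical
  obtain ⟨i₀, hi₀⟩ := Function.ne_iff.1 hA.1
  let G := (underlyingGraph V).induce {i | A.dim i ≠ 0}
  let r : V → Prop := fun k => ∃ h : A.dim k ≠ 0, G.Reachable ⟨i₀, hi₀⟩ ⟨k, h⟩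
  obtain ⟨c, hc⟩ := hA.isSchurian (fun k => if r k then 1 else 0)
    (fun k => by split_ifs; exacts [isHermitian_one, isHermitian_zero]) fun k l α => by
      by_cases hk : A.dim k = 0
      · exact matrix_eq_of_dim_eq_zero (Or.inr hk) _ _
      by_cases hl : A.dim l = 0
      · exact matrix_eq_of_dim_eq_zero (Or.inl hl) _ _
      have hkl : r k ↔ r l := by
        by_cases h : k = l
        · rw [h]
        · have hadj : G.Adj ⟨k, hk⟩ ⟨l, hl⟩ :=
            adj_of_arrow h α
          constructor
          · rintro ⟨_, h⟩
            exact ⟨hl, h.trans hadj.reachable⟩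
          · rintro ⟨_, h⟩
            exact ⟨hk, h.trans hadj.symm.reachable⟩
      by_cases h : r k
      · simp [h, hkl.1 h]
      · simp [h, mt hkl.2 h]
  have h0 : r i₀ := ⟨hi₀, SimpleGraph.Reachable.refl _⟩
  have hc0 : c - 1 = 0 := by
    refine eq_zero_of_smul_one_eq_zero (n := A.dim i₀) hi₀ ?_
    rw [sub_smul, ← hc i₀, if_pos h0, one_smul, sub_self]
  refine (SimpleGraph.connected_iff_exists_forall_reachable G).2 ⟨⟨i₀, hi₀⟩, ?_⟩
  rintro ⟨k, hk⟩
  by_contra hr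
  have hrk : ¬ r k := fun ⟨_, h⟩ => hr h
  have := hc k
  rw [if_neg hrk, sub_eq_zero.1 hc0] at this
  exact one_ne_zero (eq_zero_of_smul_one_eq_zero (𝕜 := 𝕜) hk this.symm)

variable [DecidableEq V] [∀ i j : V, Fintype (i ⟶ j)]

/-- An indecomposable representation supported on two vertices and one arrow between them has
dimension one at both vertices: its matrix is a multiple of a unitary matrix, and a projection onto
a coordinate line is carried along by it to an endomorphism. -/
theorem Indecomposable.dim_eq_of_arrow (hA : A.Indecomposable) {i j : V} (hij : i ≠ j)
    (hs : ∀ k, A.dim k ≠ 0 ↔ k = i ∨ k = j) (hi : arrowMatrix V i i = 0)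
    (hj : arrowMatrix V j j = 0) (α₀ : i ⟶ j) (hα : ∀ α : i ⟶ j, α = α₀) (hji : IsEmpty (j ⟶ i))
    (hle : A.dim j ≤ A.dim i) : A.dim = Pi.single i 1 + Pi.single j 1 := by
  have hei := isEmpty_loop hi
  have hej := isEmpty_loop hj
  have di : A.dim i ≠ 0 := (hs i).2 (Or.inl rfl)
  have dj : A.dim j ≠ 0 := (hs j).2 (Or.inr rfl)
  have key : ∀ (P : Matrix (Fin (A.dim i)) (Fin (A.dim i)) 𝕜)
      (Q : Matrix (Fin (A.dim j)) (Fin (A.dim j)) 𝕜), P.IsHermitian → Q.IsHermitian →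
      Q * A.mat α₀ = A.mat α₀ * P → ∃ c : 𝕜, P = c • 1 ∧ Q = c • 1 := by
    intro P Q hP hQ hPQ
    let H : ∀ k, Matrix (Fin (A.dim k)) (Fin (A.dim k)) 𝕜 := Function.update (Pi.single i P) j Q
    have hHj : H j = Q := Function.update_self _ _ _
    have hHi : H i = P := by
      simp only [H, Function.update_of_ne hij, Pi.single_eq_same]
    have hH0 : ∀ k, k ≠ i → k ≠ j → A.dim k = 0 := by
      intro k h1 h2
      by_contra h
      rcases (hs k).1 h with h | h
      exacts [h1 h, h2 h]
    obtain ⟨c, hc⟩ := hA.isSchurian H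
      (fun k => by
        by_cases h1 : k = i
        · subst h1; rwa [hHi]
        by_cases h2 : k = j
        · subst h2; rwa [hHj]
        exact matrix_eq_of_dim_eq_zero (Or.inl (hH0 k h1 h2)) _ _) fun k l α => by
        by_cases hk : A.dim k = 0
        · exact matrix_eq_of_dim_eq_zero (Or.inr hk) _ _
        by_cases hl : A.dim l = 0
        · exact matrix_eq_of_dim_eq_zero (Or.inl hl) _ _
        rcases (hs k).1 hk with rfl | rfl <;> rcases (hs l).1 hl with rfl | rfl
        · exact (hei.false α).elim
        · rw [hHi, hHj, hα α, hPQ]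
        · exact (hji.false α).elim
        · exact (hej.false α).elim
    exact ⟨c, hHi ▸ hc i, hHj ▸ hc j⟩
  set M := A.mat α₀
  -- `Mᴴ * M` and `M * Mᴴ` are the same scalar `c`, nonzero since otherwise `M = 0`.
  obtain ⟨c, hc1, hc2⟩ := key (Mᴴ * M) (M * Mᴴ) (isHermitian_conjTranspose_mul_self M)
    (isHermitian_mul_conjTranspose_self M) (Matrix.mul_assoc _ _ _)
  have hc0 : c ≠ 0 := by
    rintro rfl
    rw [zero_smul] at hc1
    open scoped ComplexOrder in rw [conjTranspose_mul_self_eq_zero] at hc1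
    obtain ⟨c, h1, h2⟩ := key 1 0 isHermitian_one isHermitian_zero (by simp [hc1])
    rw [eq_zero_of_smul_one_eq_zero dj h2.symm, zero_smul] at h1
    exact one_ne_zero (eq_zero_of_smul_one_eq_zero (𝕜 := 𝕜) di (by rw [one_smul, h1]))
  let x : Fin (A.dim i) := ⟨0, Nat.pos_of_ne_zero di⟩
  have hcs : star c = c := by
    have h := (isHermitian_conjTranspose_mul_self M).eq
    rw [hc1] at h
    simpa using congrFun (congrFun h x) x
  -- The projection onto one coordinate is an endomorphism, with `c⁻¹ • M * D * Mᴴ` at `j`.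
  let D : Matrix (Fin (A.dim i)) (Fin (A.dim i)) 𝕜 := diagonal (Pi.single x 1)
  have hD : Dᴴ = D := by
    rw [diagonal_conjTranspose]
    congr 1
    funext y
    by_cases hy : y = x
    · subst hy; simp
    · simp [Pi.single_eq_of_ne hy]
  obtain ⟨c', h1, -⟩ := key D (c⁻¹ • (M * D * Mᴴ)) hD
    (by
      rw [IsHermitian, conjTranspose_smul, star_inv₀, hcs, conjTranspose_mul, conjTranspose_mul,
        conjTranspose_conjTranspose, hD, Matrix.mul_assoc])
    (by
      rw [Matrix.smul_mul, Matrix.mul_assoc, hc1, Matrix.mul_smul, Matrix.mul_one, smul_smul,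
        inv_mul_cancel₀ hc0, one_smul])
  have hsub : ∀ y, y = x := by
    intro y
    by_contra hy
    have e1 := congrFun (congrFun h1 x) x
    have e2 := congrFun (congrFun h1 y) y
    simp only [D, diagonal_apply_eq, Pi.single_eq_same, Pi.single_eq_of_ne hy, Matrix.smul_apply,
      one_apply_eq, smul_eq_mul, mul_one] at e1 e2
    exact one_ne_zero (e1.trans e2.symm)
  have hdi : A.dim i = 1 := by
    have : Unique (Fin (A.dim i)) := ⟨⟨x⟩, hsub⟩
    exact (Fintype.card_fin _).symm.trans Fintype.card_unique
  funext k
  rw [Pi.add_apply]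
  by_cases h1 : k = i
  · subst h1
    rw [Pi.single_eq_same, Pi.single_eq_of_ne hij, hdi, add_zero]
  by_cases h2 : k = j
  · subst h2
    rw [Pi.single_eq_same, Pi.single_eq_of_ne h1]
    omega
  rw [Pi.single_eq_of_ne h1, Pi.single_eq_of_ne h2]
  by_contra h
  exact (hs k).1 h |>.elim h1 h2

variable [Fintype V]

/-- If the space at `i` is larger than its neighbourhood, a vector `v` killed by all adjacent
matrices splits off a one-dimensional summand: `v * vᴴ` is an endomorphism. -/
theorem Indecomposable.dim_eq_single (hA : A.Indecomposable) {i : V}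
    (hi : (A.dim ᵥ* arrowMatrix V) i < A.dim i) : A.dim = Pi.single i 1 := by
  have hloop : arrowMatrix V i i = 0 := by
    by_contra h
    exact absurd (le_vecMul_of_loop h A.dim) (by omega)
  have hempty := isEmpty_loop hloop
  let L : (Fin (A.dim i) → 𝕜) →ₗ[𝕜] (StarIndex (fun k => Fin (A.dim k)) i → 𝕜) :=
    { toFun := fun v => Sum.elim (fun p => (A.mat p.2.1 *ᵥ v) p.2.2)
        (fun p => ((A.mat p.2.1)ᴴ *ᵥ v) p.2.2)
      map_add' := fun v w => by
        funext p; rcases p with p | p <;> simp [mulVec_add]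
      map_smul' := fun c v => by
        funext p; rcases p with p | p <;> simp [mulVec_smul] }
  have hker : LinearMap.ker L ≠ ⊥ := by
    refine LinearMap.ker_ne_bot_of_finrank_lt ?_
    rw [Module.finrank_fintype_fun_eq_card, Module.finrank_fintype_fun_eq_card,
      card_starIndex _ hloop]
    simpa using hi
  obtain ⟨v, hv, hv0⟩ := Submodule.exists_mem_ne_zero_of_ne_bot hker
  have hout : ∀ (l : V) (α : i ⟶ l), A.mat α *ᵥ v = 0 := fun l α => funext fun x =>
    congrFun (LinearMap.mem_ker.1 hv) (Sum.inl ⟨l, α, x⟩)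
  have hin : ∀ (k : V) (α : k ⟶ i), (A.mat α)ᴴ *ᵥ v = 0 := fun k α => funext fun x =>
    congrFun (LinearMap.mem_ker.1 hv) (Sum.inr ⟨k, α, x⟩)
  let H : ∀ k, Matrix (Fin (A.dim k)) (Fin (A.dim k)) 𝕜 := Pi.single i (vecMulVec v (star v))
  have hHi : H i = vecMulVec v (star v) := Pi.single_eq_same _ _
  have hHk : ∀ k, k ≠ i → H k = 0 := fun k hk => Pi.single_eq_of_ne hk _
  obtain ⟨c, hc⟩ := hA.isSchurian H
    (fun k => by
      by_cases hk : k = i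
      · subst hk
        rw [hHi, IsHermitian, conjTranspose_vecMulVec, star_star]
      · rw [hHk k hk]; exact isHermitian_zero) fun k l α => by
      by_cases hk : k = i
      · subst hk
        by_cases hl : l = k
        · subst hl
          exact (hempty.false α).elim
        · rw [hHi, hHk l hl, mul_vecMulVec, hout, Matrix.zero_mul]
          ext x y; simp [vecMulVec_apply]
      · by_cases hl : l = i
        · subst hl
          have h1 := hin k α
          rw [hHi, hHk k hk, vecMulVec_mul, Matrix.mul_zero]
          have h2 := congrArg star h1
          rw [star_mulVec, conjTranspose_conjTranspose] at h2
          rw [h2]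
          ext x y; simp [vecMulVec_apply]
        · rw [hHk k hk, hHk l hl, Matrix.zero_mul, Matrix.mul_zero]
  obtain ⟨x, hx⟩ := Function.ne_iff.1 hv0
  have hvx : v x ≠ 0 := hx
  have hci := hc i
  rw [hHi] at hci
  have hcx : v x * star (v x) = c := by
    have := congrFun (congrFun hci x) x
    simpa [vecMulVec_apply] using this
  have hc0 : c ≠ 0 := by
    rw [← hcx]
    exact mul_ne_zero hvx (star_ne_zero.2 hvx)
  have hsub : ∀ y, y = x := by
    intro y
    by_contra hy
    have h1 := congrFun (congrFun hci y) y
    have h2 := congrFun (congrFun hci x) y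
    simp only [vecMulVec_apply, Matrix.smul_apply, one_apply_eq, Pi.star_apply,
      one_apply_ne (Ne.symm hy), smul_eq_mul, mul_one, mul_zero] at h1 h2
    rcases mul_eq_zero.1 h2 with h | h
    · exact hvx h
    · rw [h, mul_zero] at h1
      exact hc0 h1.symm
  funext k
  by_cases hk : k = i
  · subst hk
    rw [Pi.single_eq_same]
    have : Unique (Fin (A.dim k)) := ⟨⟨x⟩, hsub⟩
    exact (Fintype.card_fin _).symm.trans Fintype.card_unique
  · rw [Pi.single_eq_of_ne hk]
    by_contra h
    have h1 := hc k
    rw [hHk k hk] at h1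
    exact hc0 (eq_zero_of_smul_one_eq_zero h h1.symm)

theorem Indecomposable.dim_mem_dimSet (hA : A.Indecomposable) : A.dim ∈ dimSet V := by
  by_cases h1 : ∃ i, A.dim = Pi.single i 1
  · exact Or.inl h1
  have hle : ∀ i, A.dim i ≤ (A.dim ᵥ* arrowMatrix V) i := fun i => by
    by_contra! h
    exact h1 ⟨i, hA.dim_eq_single h⟩
  by_cases h2 : SuppIsArrow A.dim
  · refine Or.inr (Or.inl ?_)
    obtain ⟨i, j, hij, hs, hm, hi, hj⟩ := h2
    have hs' : ∀ k, A.dim k ≠ 0 ↔ k = i ∨ k = j := fun k => Set.ext_iff.1 hs k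
    have hsum : ∀ a b : V, a ≠ b → (∀ k, A.dim k ≠ 0 ↔ k = a ∨ k = b) →
        arrowMatrix V a b = 1 → arrowMatrix V b b = 0 → A.dim b ≤ A.dim a := by
      intro a b hab hs hm hb
      refine (hle b).trans ?_
      rw [vecMul, dotProduct, Finset.sum_eq_single a, hm, mul_one]
      · intro k _ hk
        by_cases hkb : k = b
        · rw [hkb, hb, mul_zero]
        · have : A.dim k = 0 := by
            by_contra h
            exact ((hs k).1 h).elim hk hkb
          rw [this, zero_mul]
      · simp
    have hm' : arrowMatrix V j i = 1 := by
      rw [arrowMatrix, if_neg hij.symm, add_comm]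
      rwa [arrowMatrix, if_neg hij] at hm
    have hcard : Fintype.card (i ⟶ j) + Fintype.card (j ⟶ i) = 1 := by
      rwa [arrowMatrix, if_neg hij] at hm
    have one : ∀ a b : V, Fintype.card (a ⟶ b) = 1 → ∃ α₀ : a ⟶ b, ∀ α, α = α₀ := fun a b h =>
      Fintype.card_eq_one_iff.1 h
    rcases Nat.eq_zero_or_pos (Fintype.card (j ⟶ i)) with h0 | h0
    · obtain ⟨α₀, hα⟩ := one i j (by omega)
      exact ⟨i, j, hm, hA.dim_eq_of_arrow hij hs' hi hj α₀ hα (Fintype.card_eq_zero_iff.1 h0)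
        (hsum i j hij hs' hm hj)⟩
    · obtain ⟨α₀, hα⟩ := one j i (by omega)
      have hs'' : ∀ k, A.dim k ≠ 0 ↔ k = j ∨ k = i := fun k => (hs' k).trans or_comm
      exact ⟨j, i, hm', hA.dim_eq_of_arrow hij.symm hs'' hj hi α₀ hα
        (Fintype.card_eq_zero_iff.1 (by omega)) (hsum j i hij.symm hs'' hm' hi)⟩
  refine Or.inr (Or.inr ⟨hA.1, hA.suppConnected, ?_, h2, hle⟩)
  rintro ⟨i, hs, hi⟩
  have hs' : ∀ k, A.dim k ≠ 0 ↔ k = i := fun k => Set.ext_iff.1 hs k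
  refine (hs' i).2 rfl (Nat.le_zero.1 ((hle i).trans (le_of_eq ?_)))
  rw [vecMul, dotProduct]
  refine Finset.sum_eq_zero fun k _ => ?_
  by_cases hk : k = i
  · rw [hk, hi, mul_zero]
  · rw [not_not.1 (mt (hs' k).1 hk), zero_mul]

end Necessity

end QuiverRep

/-! ### Extending indecomposable representations by one dimension -/

namespace QuiverRep

open QuiverDim

section Extension

variable {V : Type u} [Quiver.{v} V] {𝕜 : Type} [RCLike 𝕜] {A : QuiverRep 𝕜 V}

/-- A Schurian family on arbitrary finite index sets gives an indecomposable representation. -/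
theorem IsSchurian.exists_indecomposable {X : V → Type} [∀ k, Fintype (X k)]
    [∀ k, DecidableEq (X k)] {M : ∀ k l : V, (k ⟶ l) → Matrix (X l) (X k) 𝕜}
    (hM : IsSchurian M) {k : V} (hk : Fintype.card (X k) ≠ 0) :
    ∃ B : QuiverRep 𝕜 V, B.Indecomposable ∧ B.dim = fun k => Fintype.card (X k) := by
  let e : ∀ k, X k ≃ Fin (Fintype.card (X k)) := fun k => Fintype.equivFin (X k)
  let B : QuiverRep 𝕜 V := ⟨fun k => Fintype.card (X k),
    fun {k l} α => (M k l α).submatrix (e l).symm (e k).symm⟩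
  refine ⟨B, indecomposable_iff.2 ⟨Function.ne_iff.2 ⟨k, hk⟩, fun H hH hc => ?_⟩, rfl⟩
  obtain ⟨c, hc⟩ := hM (fun k => (H k).submatrix (e k) (e k)) (fun k => (hH k).submatrix _)
    fun k l α => by
      have h : (H l * (M k l α).submatrix (e l).symm (e k).symm).submatrix (e l) (e k) =
          ((M k l α).submatrix (e l).symm (e k).symm * H k).submatrix (e l) (e k) :=
        congrArg (fun N => N.submatrix (e l) (e k)) (hc k l α)
      rw [← submatrix_mul_equiv _ _ _ (e l), ← submatrix_mul_equiv _ _ _ (e k)] at h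
      simpa using h
  refine ⟨c, fun k => ?_⟩
  have h : ((H k).submatrix (e k) (e k)).submatrix (e k).symm (e k).symm =
      (c • (1 : Matrix (X k) (X k) 𝕜)).submatrix (e k).symm (e k).symm :=
    congrArg (fun N => N.submatrix (e k).symm (e k).symm) (hc k)
  have h1 : (c • (1 : Matrix (X k) (X k) 𝕜)).submatrix (e k).symm (e k).symm = c • 1 := by
    ext x y
    simp [one_apply]
  rw [h1] at h
  simpa using h

/-- A dimension vector with entries at most one and connected support is the dimension of an
indecomposable representation, whose matrices are all `1`. -/
theorem exists_indecomposable_of_le_one {z : V → ℕ} (hz : ∀ k, z k ≤ 1) (hs : SuppConnected z) :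
    ∃ B : QuiverRep 𝕜 V, B.Indecomposable ∧ B.dim = z := by
  refine ⟨⟨z, fun {k l} _ => of fun _ _ => 1⟩, indecomposable_iff.2 ⟨?_, fun H hH hc => ?_⟩, rfl⟩
  · obtain ⟨k, hk⟩ := hs.nonempty
    exact Function.ne_iff.2 ⟨k, hk⟩
  obtain ⟨⟨k₀, hk₀⟩⟩ := hs.nonempty
  have sub : ∀ k (x y : Fin (z k)), x = y := fun k x y => by
    have := hz k
    apply Fin.ext
    omega
  have edge : ∀ (k l : V) (_ : k ⟶ l) (x : Fin (z k)) (y : Fin (z l)), H l y y = H k x x := by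
    intro k l α x y
    have h := congrFun (congrFun (hc k l α) y) x
    have s1 : ∀ (n : ℕ) (_ : ∀ a b : Fin n, a = b) (f : Fin n → 𝕜) (a : Fin n),
        ∑ b, f b = f a := fun n hn f a =>
      Finset.sum_eq_single a (fun b _ hb => (hb (hn b a)).elim) (by simp)
    rw [mul_apply, mul_apply] at h
    rw [s1 _ (sub l) _ y, s1 _ (sub k) _ x] at h
    simpa using h
  have key : ∀ u w : {k | z k ≠ 0}, ((underlyingGraph V).induce {k | z k ≠ 0}).Reachable u w →
      ∀ (x : Fin (z u)) (y : Fin (z w)), H w y y = H u x x := by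
    intro u w huw
    rw [SimpleGraph.reachable_iff_reflTransGen] at huw
    induction huw with
    | refl => intro x y; rw [sub _ x y]
    | @tail a b _ hab ih =>
      intro x y
      have ha : 0 < z a := Nat.pos_of_ne_zero a.2
      rw [← ih x ⟨0, ha⟩]
      have hadj : (underlyingGraph V).Adj a b := hab
      rw [underlyingGraph, SimpleGraph.fromRel_adj] at hadj
      rcases hadj.2 with ⟨⟨α⟩⟩ | ⟨⟨α⟩⟩
      · exact edge _ _ α _ _
      · exact (edge _ _ α _ _).symm
  refine ⟨H k₀ ⟨0, Nat.pos_of_ne_zero hk₀⟩ ⟨0, Nat.pos_of_ne_zero hk₀⟩, fun k => ?_⟩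
  ext x y
  obtain rfl := sub k x y
  have hk : z k ≠ 0 := fun h => by
    have := x.2
    change x.1 < z k at this
    omega
  rw [Matrix.smul_apply, one_apply_eq, smul_eq_mul, mul_one]
  exact key ⟨k₀, hk₀⟩ ⟨k, hk⟩ (hs.preconnected _ _) _ _

/-- Entries of a matrix with distinct diagonal entries whose off-diagonal part is skew-symmetric
and has no zero entries. -/
def loopEntry (𝕜 : Type) [RCLike 𝕜] (a b : ℕ) : 𝕜 :=
  if a = b then (a : 𝕜) else if a < b then 1 else -1

/-- Only scalar Hermitian matrices commute with such a matrix: they commute with twice its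
diagonal part, the sum of the matrix and its adjoint, hence are diagonal, and the nonzero
off-diagonal entries make their diagonal constant. -/
theorem eq_smul_one_of_commute_loopEntry {n : Type} [Fintype n] [DecidableEq n] {f : n → ℕ}
    (hf : Function.Injective f) {H : Matrix n n 𝕜} (hH : H.IsHermitian)
    (hc : H * of (fun x y => loopEntry 𝕜 (f x) (f y)) =
      of (fun x y => loopEntry 𝕜 (f x) (f y)) * H) : ∃ c : 𝕜, H = c • 1 := by
  set N : Matrix n n 𝕜 := of (fun x y => loopEntry 𝕜 (f x) (f y))
  have hc' : H * Nᴴ = Nᴴ * H := by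
    have h := congrArg conjTranspose hc
    rw [conjTranspose_mul, conjTranspose_mul, hH.eq] at h
    exact h.symm
  have hN : N + Nᴴ = diagonal fun x => 2 * (f x : 𝕜) := by
    ext x y
    by_cases hxy : x = y
    · subst hxy
      simp [N, loopEntry, two_mul]
    · have h1 : f x ≠ f y := fun h => hxy (hf h)
      rw [diagonal_apply_ne _ hxy]
      rcases lt_or_gt_of_ne h1 with h | h
      · simp [N, loopEntry, h1, h1.symm, h, h.not_gt]
      · simp [N, loopEntry, h1, h1.symm, h, h.not_gt]
  have hD : H * (N + Nᴴ) = (N + Nᴴ) * H := by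
    rw [Matrix.mul_add, Matrix.add_mul, hc, hc']
  rw [hN] at hD
  have hoff : ∀ x y, x ≠ y → H x y = 0 := by
    intro x y hxy
    have h := congrFun (congrFun hD x) y
    rw [mul_diagonal, diagonal_mul] at h
    have h1 : H x y * (2 * ((f y : 𝕜) - f x)) = 0 := by linear_combination h
    refine (mul_eq_zero.1 h1).resolve_right (mul_ne_zero two_ne_zero ?_)
    rw [sub_ne_zero]
    exact fun h => hxy (hf (Nat.cast_injective h)).symm
  have hdiag : H = diagonal fun x => H x x := by
    ext x y
    by_cases hxy : x = y
    · subst hxy; simp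
    · rw [hoff x y hxy, diagonal_apply_ne _ hxy]
  have heq : ∀ x y, H x x = H y y := by
    intro x y
    by_cases hxy : x = y
    · rw [hxy]
    rw [hdiag] at hc
    have h := congrFun (congrFun hc x) y
    rw [mul_diagonal, diagonal_mul, mul_comm] at h
    refine mul_left_cancel₀ ?_ h
    have h1 : f x ≠ f y := fun h => hxy (hf h)
    simp only [N, of_apply, loopEntry, if_neg h1]
    split_ifs <;> simp
  rcases isEmpty_or_nonempty n with hn | ⟨⟨x⟩⟩
  · exact ⟨0, by ext x; exact hn.elim x⟩
  · refine ⟨H x x, ?_⟩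
    rw [hdiag, smul_one_eq_diagonal]
    congr 1
    funext y
    rw [diagonal_apply_eq, heq y x]

variable [DecidableEq V]

/-- The index sets of a family obtained by adding one coordinate at the vertex `i`. -/
abbrev ExtIndex {R : Type} (A : QuiverRep R V) (i k : V) : Type := Fin (A.dim k) ⊕ PLift (k = i)

theorem card_extIndex {R : Type} (A : QuiverRep R V) (i : V) :
    (fun k => Fintype.card (ExtIndex A i k)) = A.dim + Pi.single i 1 := by
  funext k
  rw [Fintype.card_sum, Fintype.card_fin, Pi.add_apply, add_right_inj]
  by_cases hk : k = i
  · subst hk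
    rw [Pi.single_eq_same, Fintype.card_eq_one_iff]
    exact ⟨⟨rfl⟩, fun _ => rfl⟩
  · rw [Pi.single_eq_of_ne hk, Fintype.card_eq_zero_iff]
    exact ⟨fun h => hk h.down⟩

theorem exists_indecomposable_of_isSchurian_ext {i : V}
    {M : ∀ k l : V, (k ⟶ l) → Matrix (ExtIndex A i l) (ExtIndex A i k) 𝕜} (hM : IsSchurian M) :
    ∃ B : QuiverRep 𝕜 V, B.Indecomposable ∧ B.dim = A.dim + Pi.single i 1 := by
  obtain ⟨B, hB, hd⟩ := hM.exists_indecomposable (k := i) (by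
    rw [congrFun (card_extIndex A i) i]; simp)
  exact ⟨B, hB, hd.trans (card_extIndex A i)⟩

/-- At a vertex with a loop the dimension can be raised by one: a suitable new matrix on the loops
forces endomorphisms to be scalar there. -/
theorem Indecomposable.exists_add_single_of_loop (hA : A.Indecomposable) {i : V} (α₀ : i ⟶ i)
    (hi : A.dim i ≠ 0) :
    ∃ B : QuiverRep 𝕜 V, B.Indecomposable ∧ B.dim = A.dim + Pi.single i 1 := by
  let f : ∀ k, ExtIndex A i k → ℕ := fun k => Sum.elim (fun x => x.1) (fun _ => A.dim k)
  have hf : ∀ k, Function.Injective (f k) := by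
    rintro k (x | x) (y | y) h
    · exact congrArg Sum.inl (Fin.ext h)
    · exact absurd h x.2.ne
    · exact absurd h y.2.ne'
    · exact congrArg Sum.inr (Subsingleton.elim x y)
  let M : ∀ k l : V, (k ⟶ l) → Matrix (ExtIndex A i l) (ExtIndex A i k) 𝕜 := fun k l α =>
    -- The old matrices on the loops are discarded.
    if k = i ∧ l = i then of fun x y => loopEntry 𝕜 (f l x) (f k y)
    else fromBlocks (A.mat α) 0 0 0
  refine exists_indecomposable_of_isSchurian_ext (M := M) fun H hH hc => ?_
  obtain ⟨μ, hμ⟩ := eq_smul_one_of_commute_loopEntry (hf i) (hH i) (by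
    have h := hc i i α₀
    simp only [M, if_pos (And.intro rfl rfl : i = i ∧ i = i)] at h
    exact h)
  have hPi : (H i).toBlocks₁₁ = μ • 1 := by
    rw [hμ]
    ext x y
    simp [toBlocks₁₁, one_apply]
  obtain ⟨c, hcc⟩ := hA.isSchurian (fun k => (H k).toBlocks₁₁)
    (fun k => by
      have h := hH k
      ext x y
      exact congrFun (congrFun h.eq (Sum.inl x)) (Sum.inl y))
    fun k l α => by
      by_cases hkl : k = i ∧ l = i
      · obtain ⟨rfl, rfl⟩ := hkl
        rw [hPi, Matrix.smul_mul, Matrix.mul_smul, Matrix.one_mul, Matrix.mul_one]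
      · have h := hc k l α
        simp only [M, if_neg hkl] at h
        rw [← fromBlocks_toBlocks (H l), ← fromBlocks_toBlocks (H k), fromBlocks_multiply,
          fromBlocks_multiply, fromBlocks_inj] at h
        simpa using h.1
  have hcμ : μ = c := by
    have h := hcc i
    rw [hPi] at h
    rw [← sub_eq_zero]
    exact eq_zero_of_smul_one_eq_zero hi (by rw [sub_smul, h, sub_self])
  refine ⟨c, fun k => ?_⟩
  by_cases hk : k = i
  · subst hk
    rw [hμ, hcμ]
  · ext x y
    rcases x with x | x
    · rcases y with y | y
      · have h := congrFun (congrFun (hcc k) x) y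
        rw [Matrix.smul_apply, one_apply] at h ⊢
        simp only [Sum.inl.injEq]
        exact h
      · exact (hk y.down).elim
    · exact (hk x.down).elim

end Extension

end QuiverRep

namespace QuiverRep

open QuiverDim

section Extension

variable {𝕜 : Type} [RCLike 𝕜]

/-- A wide matrix `T` has a kernel vector whose squared length is not an eigenvalue of `T * Tᴴ`,
since only finitely many lengths are excluded. -/
theorem exists_kernel_vector {m : Type} {J : Type*} [Fintype m] [DecidableEq m] [Fintype J]
    (T : Matrix m J 𝕜) (h : Fintype.card m < Fintype.card J) :
    ∃ w : J → 𝕜, w ≠ 0 ∧ T *ᵥ w = 0 ∧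
      ∀ y : m → 𝕜, (T * Tᴴ) *ᵥ y = (star w ⬝ᵥ w) • y → y = 0 := by
  have hker : LinearMap.ker T.mulVecLin ≠ ⊥ := by
    refine LinearMap.ker_ne_bot_of_finrank_lt ?_
    simpa using h
  obtain ⟨w, hw, hw0⟩ := Submodule.exists_mem_ne_zero_of_ne_bot hker
  have hw1 : T *ᵥ w = 0 := hw
  have hβ : star w ⬝ᵥ w ≠ 0 := by
    open scoped ComplexOrder in exact mt dotProduct_star_self_eq_zero.1 hw0
  obtain ⟨n, hn⟩ : ∃ n : ℕ, ¬ Module.End.HasEigenvalue (mulVecLin (T * Tᴴ))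
      (((n : 𝕜) + 1) ^ 2 * (star w ⬝ᵥ w)) := by
    by_contra! hall
    refine Set.infinite_of_injective_forall_mem (f := fun n : ℕ => ((n : 𝕜) + 1) ^ 2 *
      (star w ⬝ᵥ w)) (fun a b hab => ?_) hall (Module.End.finite_hasEigenvalue _)
    have h1 : ((a : 𝕜) + 1) ^ 2 = ((b : 𝕜) + 1) ^ 2 := mul_right_cancel₀ hβ hab
    have h2 : (a + 1) ^ 2 = (b + 1) ^ 2 := by exact_mod_cast h1
    have h3 := Nat.pow_left_injective two_ne_zero h2
    omega
  have hn1 : (n : 𝕜) + 1 ≠ 0 := Nat.cast_add_one_ne_zero n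
  refine ⟨((n : 𝕜) + 1) • w, smul_ne_zero hn1 hw0, by rw [mulVec_smul, hw1, smul_zero],
    fun y hy => ?_⟩
  by_contra hy0
  refine hn (Module.End.hasEigenvalue_of_hasEigenvector (x := y)
    (Module.End.hasEigenvector_iff.2 ⟨Module.End.mem_eigenspace_iff.2 ?_, hy0⟩))
  rw [mulVecLin_apply, hy, star_smul, smul_dotProduct, dotProduct_smul, smul_eq_mul, smul_eq_mul,
    ← mul_assoc, star_add, star_one, star_natCast, sq]

variable {V : Type u} [Quiver.{v} V] {A : QuiverRep 𝕜 V}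

/-- All matrices adjacent to the vertex `i`, turned into maps towards `i` and put side by side. -/
def starMatrix (A : QuiverRep 𝕜 V) (i : V) :
    Matrix (Fin (A.dim i)) (StarIndex (fun k => Fin (A.dim k)) i) 𝕜 :=
  of fun x => Sum.elim (fun p => star (A.mat p.2.1 p.2.2 x)) (fun p => A.mat p.2.1 x p.2.2)

/-- The new column, present if the source `k` of the arrow is the vertex `i`. -/
def newColumn {R : Type} {A : QuiverRep R V} {i : V}
    (w : StarIndex (fun k => Fin (A.dim k)) i → R) {k l : V} (α : k ⟶ l) :
    Matrix (Fin (A.dim l)) (PLift (k = i)) R :=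
  of fun y h => w (Sum.inl ⟨l, h.down ▸ α, y⟩)

/-- The new row, present if the target `l` of the arrow is the vertex `i`. -/
def newRow {i : V} (w : StarIndex (fun k => Fin (A.dim k)) i → 𝕜) {k l : V} (α : k ⟶ l) :
    Matrix (PLift (l = i)) (Fin (A.dim k)) 𝕜 :=
  of fun h y => star (w (Sum.inr ⟨k, h.down ▸ α, y⟩))

theorem newColumn_apply {R : Type} {A : QuiverRep R V} {i l : V}
    (w : StarIndex (fun k => Fin (A.dim k)) i → R) (α : i ⟶ l)
    (y : Fin (A.dim l)) (h : PLift (i = i)) : newColumn w α y h = w (Sum.inl ⟨l, α, y⟩) := rfl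

theorem newRow_apply {i k : V} (w : StarIndex (fun k => Fin (A.dim k)) i → 𝕜) (α : k ⟶ i)
    (y : Fin (A.dim k)) (h : PLift (i = i)) :
    newRow w α h y = star (w (Sum.inr ⟨k, α, y⟩)) := rfl

variable [Fintype V] [DecidableEq V] [∀ i j : V, Fintype (i ⟶ j)]

/-- At a vertex without loops the dimension can be raised by one as long as it is smaller than the
dimension of the neighbourhood.  The new rows and columns form a kernel vector `w` of
`starMatrix A i`; for an endomorphism the component `y` between the old and the new coordinate
satisfies `T Tᴴ y = ‖w‖² y`, and so vanishes. -/
theorem Indecomposable.exists_add_single (hA : A.Indecomposable) {i : V}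
    (hloop : arrowMatrix V i i = 0) (hlt : A.dim i < (A.dim ᵥ* arrowMatrix V) i) :
    ∃ B : QuiverRep 𝕜 V, B.Indecomposable ∧ B.dim = A.dim + Pi.single i 1 := by
  have hempty := isEmpty_loop hloop
  obtain ⟨w, hw0, hTw, hw⟩ := exists_kernel_vector (starMatrix A i) (by
    rw [card_starIndex _ hloop]
    simpa using hlt)
  let M : ∀ k l : V, (k ⟶ l) → Matrix (ExtIndex A i l) (ExtIndex A i k) 𝕜 := fun k l α =>
    fromBlocks (A.mat α) (newColumn w α) (newRow w α) 0
  refine exists_indecomposable_of_isSchurian_ext (M := M) fun H hH hc => ?_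
  let P : ∀ k, Matrix (Fin (A.dim k)) (Fin (A.dim k)) 𝕜 := fun k => (H k).toBlocks₁₁
  let Q : ∀ k, Matrix (Fin (A.dim k)) (PLift (k = i)) 𝕜 := fun k => (H k).toBlocks₁₂
  let R : ∀ k, Matrix (PLift (k = i)) (PLift (k = i)) 𝕜 := fun k => (H k).toBlocks₂₂
  have hP : ∀ k, (P k)ᴴ = P k := fun k => by
    ext x y; exact congrFun (congrFun (hH k).eq (Sum.inl x)) (Sum.inl y)
  have hR : ∀ k, (R k)ᴴ = R k := fun k => by
    ext x y; exact congrFun (congrFun (hH k).eq (Sum.inr x)) (Sum.inr y)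
  have hHk : ∀ k, H k = fromBlocks (P k) (Q k) (Q k)ᴴ (R k) := fun k => by
    have h : (Q k)ᴴ = (H k).toBlocks₂₁ := by
      ext x y; exact congrFun (congrFun (hH k).eq (Sum.inr x)) (Sum.inl y)
    rw [h, fromBlocks_toBlocks]
  have hblock : ∀ (k l : V) (α : k ⟶ l),
      P l * A.mat α + Q l * newRow w α = A.mat α * P k + newColumn w α * (Q k)ᴴ ∧
      P l * newColumn w α = A.mat α * Q k + newColumn w α * R k ∧
      (Q l)ᴴ * A.mat α + R l * newRow w α = newRow w α * P k := by
    intro k l α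
    have h := hc k l α
    rw [hHk l, hHk k, fromBlocks_multiply, fromBlocks_multiply, fromBlocks_inj] at h
    simp only [Matrix.mul_zero, Matrix.zero_mul, add_zero] at h
    exact ⟨h.1, h.2.1, h.2.2.1⟩
  have hQne : ∀ k, k ≠ i → Q k = 0 := fun k hk => by
    ext x y; exact (hk y.down).elim
  -- The matrix `T * diag(P)`, where `T = starMatrix A i`.
  let TP : Matrix (Fin (A.dim i)) (StarIndex (fun k => Fin (A.dim k)) i) 𝕜 :=
    of fun x => Sum.elim (fun p => ((A.mat p.2.1)ᴴ * P p.1) x p.2.2)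
      (fun p => (A.mat p.2.1 * P p.1) x p.2.2)
  -- The matrix `diag(P) * w`.
  let Pw : Matrix (StarIndex (fun k => Fin (A.dim k)) i) (PLift (i = i)) 𝕜 :=
    of fun p h => Sum.elim (fun p => (P p.1 * newColumn w p.2.1) p.2.2 h)
      (fun p => (P p.1 * (newRow w p.2.1)ᴴ) p.2.2 h) p
  let W : Matrix (StarIndex (fun k => Fin (A.dim k)) i) (PLift (i = i)) 𝕜 := of fun p _ => w p
  set T := starMatrix A i
  have hTW : T * W = 0 := by
    ext x h
    exact congrFun hTw x
  -- Commutation of the blocks towards the old coordinates.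
  have e1 : TP = P i * T + Q i * Wᴴ := by
    ext x p
    rcases p with ⟨l, α, y⟩ | ⟨k, α, y⟩
    · have hl : l ≠ i := by
        rintro rfl
        exact hempty.false α
      have h := (hblock i l α).1
      rw [hQne l hl, Matrix.zero_mul, add_zero] at h
      have h1 := congrArg conjTranspose h
      rw [conjTranspose_mul, conjTranspose_add, conjTranspose_mul, conjTranspose_mul,
        conjTranspose_conjTranspose, hP, hP] at h1
      exact congrFun (congrFun h1 x) y
    · have hk : k ≠ i := by
        rintro rfl
        exact hempty.false α
      have h := (hblock k i α).1
      rw [hQne k hk, conjTranspose_zero, Matrix.mul_zero, add_zero] at h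
      exact (congrFun (congrFun h x) y).symm
  -- Commutation of the blocks between the old and the new coordinates.
  have e2 : Pw = Tᴴ * Q i + W * R i := by
    ext p u
    rcases p with ⟨l, α, y⟩ | ⟨k, α, y⟩
    · have h := congrFun (congrFun (hblock i l α).2.1 y) u
      refine h.trans ?_
      rw [Matrix.add_apply, Matrix.add_apply, mul_apply, mul_apply]
      congr 1
      rw [mul_apply]
      refine Finset.sum_congr rfl fun x _ => ?_
      change A.mat α y x * Q i x u = star (star (A.mat α y x)) * Q i x u
      rw [star_star]
    · have h := congrArg conjTranspose (hblock k i α).2.2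
      rw [conjTranspose_add, conjTranspose_mul, conjTranspose_mul, conjTranspose_mul,
        conjTranspose_conjTranspose, hP, hR] at h
      refine (congrFun (congrFun h y) u).symm.trans ?_
      rw [Matrix.add_apply, Matrix.add_apply]
      congr 1
      rw [mul_apply, mul_apply]
      refine Finset.sum_congr rfl fun x _ => ?_
      rw [conjTranspose_apply, newRow_apply, star_star]
      rfl
  have e3 : TP * W = T * Pw := by
    ext x u
    rw [mul_apply, mul_apply, Fintype.sum_sum_type, Fintype.sum_sum_type, Fintype.sum_sigma,
      Fintype.sum_sigma, Fintype.sum_sigma, Fintype.sum_sigma]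
    congr 1
    · refine Finset.sum_congr rfl fun l _ => ?_
      rw [Fintype.sum_prod_type, Fintype.sum_prod_type]
      refine Finset.sum_congr rfl fun α _ => ?_
      exact congrFun (congrFun (Matrix.mul_assoc (A.mat α)ᴴ (P l) (newColumn w α)) x) u
    · refine Finset.sum_congr rfl fun k _ => ?_
      rw [Fintype.sum_prod_type, Fintype.sum_prod_type]
      refine Finset.sum_congr rfl fun α _ => ?_
      have h := congrFun (congrFun (Matrix.mul_assoc (A.mat α) (P k) (newRow w α)ᴴ) x) u
      rw [mul_apply] at h
      refine Eq.trans (Finset.sum_congr rfl fun y _ => ?_) h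
      rw [conjTranspose_apply, newRow_apply, star_star]
      rfl
  have hQi : Q i = 0 := by
    have h1 : T * Tᴴ * Q i = Q i * (Wᴴ * W) := by
      calc T * Tᴴ * Q i = T * Pw := by
            rw [e2, Matrix.mul_add, ← Matrix.mul_assoc T W, hTW, Matrix.zero_mul, add_zero,
              Matrix.mul_assoc]
        _ = Q i * (Wᴴ * W) := by
            rw [← e3, e1, Matrix.add_mul, Matrix.mul_assoc, hTW, Matrix.mul_zero, zero_add,
              Matrix.mul_assoc]
    have h2 : Wᴴ * W = (star w ⬝ᵥ w) • 1 := by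
      ext ⟨a⟩ ⟨b⟩
      rw [Matrix.smul_apply, one_apply_eq, smul_eq_mul, mul_one]
      rfl
    rw [h2, Matrix.mul_smul, Matrix.mul_one] at h1
    have h3 := hw (fun x => Q i x ⟨rfl⟩) (funext fun x => congrFun (congrFun h1 x) ⟨rfl⟩)
    ext x u
    exact congrFun h3 x
  have hQ : ∀ k, Q k = 0 := fun k => by
    by_cases hk : k = i
    · subst hk; exact hQi
    · exact hQne k hk
  simp only [hQ, Matrix.zero_mul, conjTranspose_zero, Matrix.mul_zero, add_zero,
    zero_add] at hblock
  obtain ⟨c, hcc⟩ := hA.isSchurian P (fun k => hP k) fun k l α => (hblock k l α).1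
  simp only [hcc, Matrix.smul_mul, Matrix.one_mul, Matrix.mul_smul, Matrix.mul_one] at hblock
  -- A nonzero entry of `w` transfers the scalar `c` to the new coordinate.
  let u₀ : PLift (i = i) := ⟨rfl⟩
  have hRi : R i = c • 1 := by
    have hmul : ∀ (n : ℕ) (N : Matrix (Fin n) (PLift (i = i)) 𝕜) (x : Fin n),
        (N * R i) x u₀ = N x u₀ * R i u₀ u₀ := fun n N x => by
      rw [mul_apply]
      exact Finset.sum_eq_single u₀ (fun b _ hb => (hb (Subsingleton.elim _ _)).elim) (by simp)
    have hmul' : ∀ (n : ℕ) (N : Matrix (PLift (i = i)) (Fin n) 𝕜) (x : Fin n),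
        (R i * N) u₀ x = R i u₀ u₀ * N u₀ x := fun n N x => by
      rw [mul_apply]
      exact Finset.sum_eq_single u₀ (fun b _ hb => (hb (Subsingleton.elim _ _)).elim) (by simp)
    have hs : R i u₀ u₀ = c := by
      obtain ⟨p, hp⟩ := Function.ne_iff.1 hw0
      rcases p with ⟨l, α, y⟩ | ⟨k, α, y⟩
      · have h := congrFun (congrFun (hblock i l α).2.1 y) u₀
        rw [hmul, Matrix.smul_apply, smul_eq_mul, mul_comm, newColumn_apply] at h
        exact (mul_left_cancel₀ hp h).symm
      · have h := congrFun (congrFun (hblock k i α).2.2 u₀) y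
        rw [hmul', Matrix.smul_apply, smul_eq_mul, newRow_apply] at h
        exact mul_right_cancel₀ (star_ne_zero.2 hp) h
    ext ⟨a⟩ ⟨b⟩
    rw [Matrix.smul_apply, one_apply_eq, smul_eq_mul, mul_one]
    exact hs
  refine ⟨c, fun k => ?_⟩
  have hRk : R k = c • 1 := by
    by_cases hk : k = i
    · subst hk; exact hRi
    · ext x; exact (hk x.down).elim
  rw [hHk k, hQ, hcc, hRk, conjTranspose_zero, ← fromBlocks_one, fromBlocks_smul, smul_zero,
    smul_zero]

end Extension

end QuiverRep

/-! ### The set of dimensions of indecomposable representations -/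

namespace QuiverDim

variable {V : Type u} [Quiver.{v} V]

/-- A support all of whose vertices are joined to one of them is connected. -/
theorem suppConnected_of_star {z : V → ℕ} {i : V} (hi : z i ≠ 0)
    (h : ∀ k, z k ≠ 0 → k = i ∨ Nonempty (i ⟶ k) ∨ Nonempty (k ⟶ i)) : SuppConnected z := by
  refine (SimpleGraph.connected_iff_exists_forall_reachable _).2 ⟨⟨i, hi⟩, ?_⟩
  rintro ⟨k, hk⟩
  by_cases hki : k = i
  · subst hki
    exact SimpleGraph.Reachable.refl _
  have hadj : (underlyingGraph V).Adj i k := by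
    rcases (h k hk).resolve_left hki with ⟨⟨α⟩⟩ | ⟨⟨α⟩⟩
    · exact adj_of_arrow (Ne.symm hki) α
    · exact (adj_of_arrow hki α).symm
  exact SimpleGraph.Adj.reachable hadj

theorem update_add_single {V : Type u} [DecidableEq V] {z : V → ℕ} {i : V} (hi : z i ≠ 0) :
    Function.update z i (z i - 1) + Pi.single i 1 = z := by
  funext k
  by_cases hk : k = i
  · subst hk
    simp only [Pi.add_apply, Function.update_self, Pi.single_eq_same]
    omega
  · simp [hk]

variable [DecidableEq V] [∀ i j : V, Fintype (i ⟶ j)]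

theorem arrowMatrix_comm (i j : V) : arrowMatrix V i j = arrowMatrix V j i := by
  by_cases h : i = j
  · rw [h]
  · rw [arrowMatrix, arrowMatrix, if_neg h, if_neg (Ne.symm h), add_comm]

theorem arrowMatrix_ne_zero_of_adj {i j : V} (h : (underlyingGraph V).Adj i j) :
    arrowMatrix V i j ≠ 0 := by
  rw [underlyingGraph, SimpleGraph.fromRel_adj] at h
  rw [arrowMatrix, if_neg h.1]
  rcases h.2 with ⟨⟨α⟩⟩ | ⟨⟨α⟩⟩
  · have : 0 < Fintype.card (i ⟶ j) := Fintype.card_pos_iff.2 ⟨α⟩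
    omega
  · have : 0 < Fintype.card (j ⟶ i) := Fintype.card_pos_iff.2 ⟨α⟩
    omega

theorem nonempty_of_arrowMatrix_ne_zero {i j : V} (h : arrowMatrix V i j ≠ 0) :
    Nonempty (i ⟶ j) ∨ Nonempty (j ⟶ i) := by
  rw [← Fintype.card_pos_iff, ← Fintype.card_pos_iff]
  by_cases hij : i = j
  · subst hij
    rw [arrowMatrix, if_pos rfl] at h
    omega
  · rw [arrowMatrix, if_neg hij] at h
    omega

variable [Fintype V]

theorem vecMul_update {z : V → ℕ} {i : V} (hi : z i ≠ 0) (k : V) :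
    (Function.update z i (z i - 1) ᵥ* arrowMatrix V) k + arrowMatrix V i k =
      (z ᵥ* arrowMatrix V) k := by
  have h := congrArg (fun y => (y ᵥ* arrowMatrix V) k) (update_add_single hi)
  simpa only [add_vecMul, single_one_vecMul, Pi.add_apply, Matrix.row] using h

theorem vecMul_eq_add (z : V → ℕ) (i k : V) : (z ᵥ* arrowMatrix V) k =
    z i * arrowMatrix V i k + ∑ l ∈ Finset.univ.erase i, z l * arrowMatrix V l k := by
  exact (Finset.add_sum_erase _ (fun l => z l * arrowMatrix V l k) (Finset.mem_univ i)).symm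

/-- A dimension vector `z ≤ z M` with an entry at least two still satisfies this inequality after a
suitable entry at least two is lowered by one: a maximal entry, or the entry at a vertex joined to
it by a single arrow and to no other vertex of the support. -/
theorem exists_update_le {z : V → ℕ} (hs : SuppConnected z) (ha : ¬ SuppIsArrow z)
    (hle : z ≤ z ᵥ* arrowMatrix V) (hz : ∃ k, 2 ≤ z k) :
    ∃ i, 2 ≤ z i ∧
      Function.update z i (z i - 1) ≤ Function.update z i (z i - 1) ᵥ* arrowMatrix V := by
  obtain ⟨k₀, hk₀⟩ := hz
  have : Nonempty V := ⟨k₀⟩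
  obtain ⟨i, hmax⟩ := Finite.exists_max z
  have hi : 2 ≤ z i := hk₀.trans (hmax k₀)
  by_cases hgood : Function.update z i (z i - 1) ≤ Function.update z i (z i - 1) ᵥ* arrowMatrix V
  · exact ⟨i, hi, hgood⟩
  rw [Pi.le_def] at hgood
  push Not at hgood
  obtain ⟨j, hj⟩ := hgood
  have hjj : arrowMatrix V j j = 0 := by
    by_contra h
    exact absurd (le_vecMul_of_loop h (Function.update z i (z i - 1))) (by omega)
  have hSj := vecMul_update (V := V) (z := z) (i := i) (by omega) j
  have hij : j ≠ i := by
    rintro rfl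
    rw [Function.update_self] at hj
    have h1 : z j ≤ (z ᵥ* arrowMatrix V) j := hle j
    omega
  rw [Function.update_of_ne hij] at hj
  have hdec := vecMul_eq_add z i j
  have hlej : z j ≤ (z ᵥ* arrowMatrix V) j := hle j
  have hzj := hmax j
  set R := ∑ l ∈ Finset.univ.erase i, z l * arrowMatrix V l j with hR
  set m := arrowMatrix V i j with hm
  have hm0 : m ≠ 0 := by
    intro h
    omega
  -- Lowering the maximal entry `z i` violates the inequality at `j` only if there is one arrow
  -- between `i` and `j` and no other vertex of the support is joined to `j`.
  obtain ⟨hm1, hR0⟩ : m = 1 ∧ R = 0 := by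
    have h1 : z i * m + R < z j + m := by omega
    have h2 : z i * m + R < z i + m := by omega
    obtain ⟨a, ha⟩ : ∃ a, z i = a + 2 := ⟨z i - 2, by omega⟩
    obtain ⟨b, hb⟩ : ∃ b, m = b + 1 := ⟨m - 1, by omega⟩
    rw [ha, hb] at h2
    have h3 : (a + 2) * (b + 1) = a * b + a + 2 * b + 2 := by ring
    have h4 : 0 ≤ a * b := Nat.zero_le _
    omega
  have hzij : z j = z i := by
    rw [hm1, hR0] at hdec
    omega
  have hnbr : ∀ k, k ≠ i → z k ≠ 0 → arrowMatrix V k j = 0 := by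
    intro k hk hzk
    have h1 := (Finset.sum_eq_zero_iff.1 hR0) k (Finset.mem_erase.2 ⟨hk, Finset.mem_univ _⟩)
    exact (Nat.mul_eq_zero.1 h1).resolve_left hzk
  -- In that case the entry at `j`, which is maximal too, can be lowered.
  refine ⟨j, by omega, fun k => ?_⟩
  change Function.update z j (z j - 1) k ≤ (Function.update z j (z j - 1) ᵥ* arrowMatrix V) k
  have hSk := vecMul_update (V := V) (z := z) (i := j) (by omega) k
  have hlek : z k ≤ (z ᵥ* arrowMatrix V) k := hle k
  have hupd : Function.update z j (z j - 1) k ≤ z k := by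
    by_cases hkj : k = j
    · subst hkj
      rw [Function.update_self]
      omega
    · rw [Function.update_of_ne hkj]
  by_cases hki : k = i
  · subst hki
    rw [Function.update_of_ne hij.symm]
    rw [arrowMatrix_comm, ← hm, hm1] at hSk
    by_contra hlt
    -- Otherwise the vertices `k` and `j` with their arrow are a component of the support.
    have hdec' := vecMul_eq_add z j k
    rw [arrowMatrix_comm, ← hm, hm1] at hdec'
    have hR' : ∑ l ∈ Finset.univ.erase j, z l * arrowMatrix V l k = 0 := by omega
    have hnbr' : ∀ l, l ≠ j → z l ≠ 0 → arrowMatrix V l k = 0 := by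
      intro l hl hzl
      have h1 := (Finset.sum_eq_zero_iff.1 hR') l (Finset.mem_erase.2 ⟨hl, Finset.mem_univ _⟩)
      exact (Nat.mul_eq_zero.1 h1).resolve_left hzl
    refine ha ⟨k, j, hij.symm, ?_, hm1, hnbr' k hij.symm (by omega), hjj⟩
    have hreach : ∀ u w : {l | z l ≠ 0},
        ((underlyingGraph V).induce {l | z l ≠ 0}).Reachable u w →
        (u : V) = k ∨ (u : V) = j → (w : V) = k ∨ (w : V) = j := by
      intro u w huw hu
      rw [SimpleGraph.reachable_iff_reflTransGen] at huw
      induction huw with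
      | refl => exact hu
      | @tail a b _ hab ih =>
        have hadj : (underlyingGraph V).Adj a b := hab
        have hne := arrowMatrix_ne_zero_of_adj hadj.symm
        by_contra! hb
        rcases ih with h | h
        · rw [h] at hne
          exact hne (hnbr' b hb.2 b.2)
        · rw [h] at hne
          exact hne (hnbr b hb.1 b.2)
    ext l
    constructor
    · intro hl
      exact hreach ⟨k, by change z k ≠ 0; omega⟩ ⟨l, hl⟩ (hs.preconnected _ _) (Or.inl rfl)
    · rintro (rfl | rfl)
      · change z l ≠ 0; omega
      · change z l ≠ 0; omega
  · by_cases hzk : z k = 0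
    · omega
    · rw [arrowMatrix_comm, hnbr k hki hzk] at hSk
      omega

end QuiverDim

namespace QuiverRep

open QuiverDim

variable {V : Type u} [Quiver.{v} V] [Fintype V] [DecidableEq V] [∀ i j : V, Fintype (i ⟶ j)]
  {𝕜 : Type} [RCLike 𝕜]

variable (𝕜) in
/-- By induction on the sum of the entries: a suitable entry is lowered by one, and an
indecomposable representation of the smaller dimension is extended. -/
theorem exists_indecomposable_of_le {z : V → ℕ} (hs : SuppConnected z) (ha : ¬ SuppIsArrow z)
    (hle : z ≤ z ᵥ* arrowMatrix V) : ∃ B : QuiverRep 𝕜 V, B.Indecomposable ∧ B.dim = z := by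
  induction hn : ∑ k, z k using Nat.strong_induction_on generalizing z with
  | _ n ih =>
    subst hn
    by_cases hz : ∃ k, 2 ≤ z k
    · obtain ⟨i, hi, hle'⟩ := exists_update_le hs ha hle hz
      set z' := Function.update z i (z i - 1) with hz'
      have hsum : z' + Pi.single i 1 = z := update_add_single (by omega)
      have hz'i : z' i = z i - 1 := Function.update_self _ _ _
      have hsupp : {k | z' k ≠ 0} = {k | z k ≠ 0} := by
        ext k
        by_cases hk : k = i
        · subst hk
          simp only [Set.mem_ofPred_eq]
          omega
        · simp [hz', hk]
      obtain ⟨A, hA, hd⟩ := ih (∑ k, z' k) (by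
          refine Finset.sum_lt_sum (fun k _ => ?_) ⟨i, Finset.mem_univ _, by omega⟩
          rw [← hsum]
          exact Nat.le_add_right _ _) (z := z')
        (by rw [SuppConnected, hsupp]; exact hs) (by rw [SuppIsArrow, hsupp]; exact ha) hle' rfl
      rw [← hsum, ← hd]
      by_cases hloop : arrowMatrix V i i = 0
      · refine hA.exists_add_single hloop ?_
        have h1 := vecMul_update (V := V) (z := z) (i := i) (by omega) i
        have h2 : z i ≤ (z ᵥ* arrowMatrix V) i := hle i
        rw [hd]
        rw [← hz', hloop] at h1
        omega
      · obtain ⟨⟨α⟩⟩ | ⟨⟨α⟩⟩ := nonempty_of_arrowMatrix_ne_zero hloop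
        all_goals exact hA.exists_add_single_of_loop α (by rw [hd]; omega)
    · push Not at hz
      exact exists_indecomposable_of_le_one (fun k => by have := hz k; omega) hs

variable (𝕜) in
theorem exists_indecomposable_of_mem_dimSet {z : V → ℕ} (hz : z ∈ dimSet V) :
    ∃ B : QuiverRep 𝕜 V, B.Indecomposable ∧ B.dim = z := by
  -- The inequality `z ≤ z M` already excludes a support that is a point.
  rcases hz with ⟨i, rfl⟩ | ⟨i, j, hm, rfl⟩ | ⟨-, hs, -, ha, hle⟩
  · refine exists_indecomposable_of_le_one (fun k => ?_)
      (suppConnected_of_star (i := i) (by simp) fun k hk => Or.inl ?_)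
    · by_cases hk : k = i
      · subst hk; simp
      · simp [hk]
    · by_contra h
      exact hk (Pi.single_eq_of_ne h _)
  · have hstar : SuppConnected (Pi.single i 1 + Pi.single j 1 : V → ℕ) := by
      refine suppConnected_of_star (i := i) (by simp) fun k hk => ?_
      by_cases hki : k = i
      · exact Or.inl hki
      · refine Or.inr ?_
        by_cases hkj : k = j
        · subst hkj
          exact nonempty_of_arrowMatrix_ne_zero (by omega)
        · simp [hki, hkj] at hk
    by_cases hij : i = j
    · -- The vector `2 eᵢ` at a vertex with one loop satisfies `z ≤ z M`.
      subst hij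
      refine exists_indecomposable_of_le 𝕜 hstar ?_ fun k => ?_
      · rintro ⟨a, b, hab, hs, -⟩
        have h1 : ∀ k, k = a ∨ k = b → k = i := fun k hk => by
          by_contra hki
          exact (Set.ext_iff.1 hs k).2 hk (by simp [hki])
        exact hab ((h1 a (Or.inl rfl)).trans (h1 b (Or.inr rfl)).symm)
      · by_cases hk : k = i
        · subst hk
          exact le_vecMul_of_loop (by omega) _
        · simp [hk]
    · refine exists_indecomposable_of_le_one (fun k => ?_) hstar
      rw [Pi.add_apply, Pi.single_apply, Pi.single_apply]
      by_cases h1 : k = i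
      · rw [if_pos h1, if_neg (fun h => hij (h1.symm.trans h)), add_zero]
      · rw [if_neg h1]
        split_ifs <;> omega
  · exact exists_indecomposable_of_le 𝕜 hs ha hle

variable (𝕜 V) in
theorem setOf_dim_indecomposable :
    {d : V → ℕ | ∃ A : QuiverRep 𝕜 V, A.Indecomposable ∧ A.dim = d} = dimSet V := by
  ext d
  constructor
  · rintro ⟨A, hA, rfl⟩
    exact hA.dim_mem_dimSet
  · exact exists_indecomposable_of_mem_dimSet 𝕜

end QuiverRep

theorem theorem4p1p1 (V : Type u) [Quiver.{v} V] [Fintype V] [DecidableEq V]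
    [∀ i j : V, Fintype (i ⟶ j)] :
    -- part (a)
    (∀ A B : QuiverRep ℝ V, A.Isometric B ↔ A.complexify.Isometric B.complexify) ∧
    -- part (b), existence of a decomposition
    (∀ A : QuiverRep ℝ V, ∃ L : List (QuiverRep ℝ V),
      (∀ B ∈ L, B.Indecomposable) ∧ A.Isometric (QuiverRep.listSum L)) ∧
    -- part (b), uniqueness of the summands up to order and isometry
    (∀ (A : QuiverRep ℝ V) (L L' : List (QuiverRep ℝ V)),
      (∀ B ∈ L, B.Indecomposable) → (∀ B ∈ L', B.Indecomposable) →
      A.Isometric (QuiverRep.listSum L) → A.Isometric (QuiverRep.listSum L') →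
      ∃ L'' : List (QuiverRep ℝ V), L.Perm L'' ∧ List.Forall₂ QuiverRep.Isometric L'' L') ∧
    -- part (b), description of the indecomposables
    (∀ I K : Set (QuiverRep ℂ V),
      QuiverRep.IsNormalizedCompleteSystem I → QuiverRep.IsIndOne I K →
      QuiverRep.IsCompleteSystem (QuiverRep.indZero I ∪ QuiverRep.realify '' K)) ∧
    -- part (c)
    ({d : V → ℕ | ∃ A : QuiverRep ℝ V, A.Indecomposable ∧ A.dim = d} =
      {d : V → ℕ | ∃ A : QuiverRep ℂ V, A.Indecomposable ∧ A.dim = d} ∧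
    {d : V → ℕ | ∃ A : QuiverRep ℝ V, A.Indecomposable ∧ A.dim = d} =
      QuiverDim.dimSet V) :=
  ⟨fun _ _ => QuiverRep.isometric_iff_complexify,
    QuiverRep.exists_listSum,
    fun _ _ _ hL hL' h h' => QuiverRep.exists_perm_forall₂ hL hL' fun X => by
      rw [← h.homDim_eq, h'.homDim_eq],
    fun _ _ => QuiverRep.isCompleteSystem_indZero_union,
    (QuiverRep.setOf_dim_indecomposable V ℝ).trans
      (QuiverRep.setOf_dim_indecomposable V ℂ).symm,
    QuiverRep.setOf_dim_indecomposable V ℝ⟩
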